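/- Let $K\ge 1$, $d_1,\dots,d_K\ge 1$, $R\ge 1$ be integers and let $\alpha,\sigma>0$. Let $f$ be one of the following link functions with scale $\sigma$: the logistic link $f(\theta)=(1+e^{-\theta/\sigma})^{-1}$; the probit link $f(\theta)=\Phi(\theta/\sigma)$, where $\Phi$ is the standard Gaussian distribution function; or the Laplacian link $f(\theta)=\frac12 e^{\theta/\sigma}$ for $\theta<0$ and $f(\theta)=1-\frac12 e^{-\theta/\sigma}$ for $\theta\ge 0$. The CP rank of a tensor $\Theta\in\mathbb{R}^{d_1\times\cdots\times d_K}$ is the least $r$ for which $\Theta=\sum_{s=1}^{r}\lambda_s\, a^{(1)}_s\otimes\cdots\otimes a^{(K)}_s$ with $\lambda_1\ge\cdots\ge\lambda_r>0$ and Euclidean unit vectors $a^{(k)}_s\in\mathbb{R}^{d_k}$. Let $\mathcal{D}$ be a compact set of tensors in $\mathbb{R}^{d_1\times\cdots\times d_K}$, each of which has CP rank exactly $R$ and all entries bounded by $\alpha$ in absolute value, and let $\Theta_{\rm true}\in\mathcal{D}$. Let $\mathcal{Y}\in\{0,1\}^{d_1\times\cdots\times d_K}$ be a random tensor with mutually independent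 entries and $\mathbb{P}(\mathcal{Y}_{i}=1)=f(\Theta_{{\rm true},i})$ for every index $i=(i_1,\dots,i_K)$. Let $\hat\Theta_{\rm MLE}=\hat\Theta_{\rm MLE}(\mathcal{Y})$ be any maximizer over $\Theta\in\mathcal{D}$ of the log-likelihood $$\mathcal{L}_{\mathcal{Y}}(\Theta)=\sum_{i}\bigl[\mathbf{1}_{\{\mathcal{Y}_i=1\}}\log f(\Theta_i)+\mathbf{1}_{\{\mathcal{Y}_i=0\}}\log(1-f(\Theta_i))\bigr],$$ and put $\mathrm{Loss}(\hat\Theta,\Theta_{\rm true})=\bigl(\prod_k d_k\bigr)^{-1/2}\|\hat\Theta-\Theta_{\rm true}\|_F$, where $\|\cdot\|_F$ is the Frobenius norm. There exist an absolute constant $C'>0$ and constants $C_1,C_2,C_3>0$ that depend only on $K$ such that, with probability at least $1-\exp\bigl(-C'\log K\,\sum_k d_k\bigr)$, $$\mathrm{Loss}(\hat\Theta_{\rm MLE},\Theta_{\rm true})\le\min\left\{2\alpha,\ C(\alpha,\sigma)\sqrt{\frac{R^{K-1}\sum_k d_k}{\prod_k d_k}}\right\},$$ where $$C(\alpha,\sigma)=\begin{cases}C_1\,\sigma\left(2+e^{\alpha/\sigma}+e^{-\alpha/\sigma}\right)&\text{for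 the logistic link},\\[2pt] C_2\,\sigma\left(\dfrac{\alpha+\sigma}{6\alpha+\sigma}\right)e^{\alpha^2/\sigma^2}&\text{for the probit link},\\[2pt] C_3\,\sigma\,e^{\alpha/\sigma}&\text{for the Laplacian link}.\end{cases}$$ -/

import Mathlib

open MeasureTheory ProbabilityTheory

noncomputable section

namespace BinaryTensor

/-- The index set `[d₁] × ⋯ × [d_K]` of an order-`K` tensor of dimension `(d₁, …, d_K)`. -/
abbrev Idx {K : ℕ} (d : Fin K → ℕ) : Type := (k : Fin K) → Fin (d k)

/-- Real tensors in `ℝ^{d₁ × ⋯ × d_K}`. -/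
abbrev RealTensor {K : ℕ} (d : Fin K → ℕ) : Type := Idx d → ℝ

/-- Binary tensors in `{0,1}^{d₁ × ⋯ × d_K}`, with `true` for `1` and `false` for `0`. -/
abbrev BinTensor {K : ℕ} (d : Fin K → ℕ) : Type := Idx d → Bool

/-- `Θ = ∑_{r ≤ R} w_r a_r^{(1)} ⊗ ⋯ ⊗ a_r^{(K)}` with `w₁ ≥ ⋯ ≥ w_R > 0` and Euclidean unit
vectors `a_r^{(k)} ∈ S^{d_k - 1}`. -/
def HasCPDecomposition {K : ℕ} {d : Fin K → ℕ} (Θ : RealTensor d) (R : ℕ) : Prop :=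
  ∃ (w : Fin R → ℝ) (a : Fin R → (k : Fin K) → EuclideanSpace ℝ (Fin (d k))),
    Antitone w ∧ (∀ r, 0 < w r) ∧ (∀ r k, ‖a r k‖ = 1) ∧
      ∀ i : Idx d, Θ i = ∑ r, w r * ∏ k, a r k (i k)

/-- `rank(Θ) = R`: the least number of terms in a CP decomposition of `Θ` is `R`. -/
def HasCPRank {K : ℕ} {d : Fin K → ℕ} (Θ : RealTensor d) (R : ℕ) : Prop :=
  IsLeast {r : ℕ | HasCPDecomposition Θ r} R

/-- The set of tensors of CP rank `R` all of whose entries are at most `α` in absolute value. -/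
def signalSet {K : ℕ} (d : Fin K → ℕ) (R : ℕ) (α : ℝ) : Set (RealTensor d) :=
  {Θ | HasCPRank Θ R ∧ ∀ i, |Θ i| ≤ α}

/-- The three link functions, each with a scale parameter `σ`. -/
inductive Link : Type
  | logistic
  | probit
  | laplacian

/-- The link function `f = f_σ : ℝ → [0,1]`. For the probit link, the value is `Φ(θ / σ)` with `Φ`
the distribution function of the standard Gaussian law. -/
def Link.fn : Link → ℝ → ℝ → ℝ
  | .logistic, σ, θ => (1 + Real.exp (-θ / σ))⁻¹
  | .probit, σ, θ => cdf (gaussianReal 0 1) (θ / σ)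
  | .laplacian, σ, θ =>
      if θ < 0 then (1 / 2) * Real.exp (θ / σ) else 1 - (1 / 2) * Real.exp (-θ / σ)

/-- The factor `C(α, σ)` of the error bound, with constants `C₁, C₂, C₃`. -/
def Link.scaleFactor (C₁ C₂ C₃ : ℝ) : Link → ℝ → ℝ → ℝ
  | .logistic, α, σ => C₁ * σ * (2 + Real.exp (α / σ) + Real.exp (-α / σ))
  | .probit, α, σ => C₂ * σ * ((α + σ) / (6 * α + σ)) * Real.exp (α ^ 2 / σ ^ 2)
  | .laplacian, α, σ => C₃ * σ * Real.exp (α / σ)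

/-- The random binary tensor `Y` has mutually independent entries with
`P(Y_i = 1) = f(Θ_i)` for all `i`. -/
structure FollowsBernoulliModel {K : ℕ} {d : Fin K → ℕ} {Ω : Type*} [MeasurableSpace Ω]
    (μ : Measure Ω) (f : ℝ → ℝ) (Θ : RealTensor d) (Y : Ω → BinTensor d) : Prop where
  measurable : ∀ i, Measurable fun ω => Y ω i
  indep : iIndepFun (fun i ω => Y ω i) μ
  prob_one : ∀ i, μ.real {ω | Y ω i = true} = f (Θ i)

/-- The log-likelihood `L_y(Θ) = ∑_i [1_{y_i = 1} log f(Θ_i) + 1_{y_i = 0} log (1 - f(Θ_i))]`. -/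
def logLikelihood {K : ℕ} {d : Fin K → ℕ} (f : ℝ → ℝ) (y : BinTensor d) (Θ : RealTensor d) : ℝ :=
  ∑ i, if y i = true then Real.log (f (Θ i)) else Real.log (1 - f (Θ i))

/-- `Θhat` is a maximizer over `D` of the log-likelihood at the data `y`. -/
def IsConstrainedMLE {K : ℕ} {d : Fin K → ℕ} (f : ℝ → ℝ) (D : Set (RealTensor d))
    (y : BinTensor d) (Θhat : RealTensor d) : Prop :=
  Θhat ∈ D ∧ IsMaxOn (logLikelihood f y) D Θhat

/-- The Frobenius norm. -/
def frobeniusNorm {K : ℕ} {d : Fin K → ℕ} (A : RealTensor d) : ℝ :=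
  Real.sqrt (∑ i, A i ^ 2)

/-- `Loss(Θ₁, Θ₂) = ‖Θ₁ - Θ₂‖_F / √(∏_k d_k)`. -/
def loss {K : ℕ} {d : Fin K → ℕ} (Θ₁ Θ₂ : RealTensor d) : ℝ :=
  (1 / Real.sqrt (∏ k, (d k : ℝ))) * frobeniusNorm (Θ₁ - Θ₂)

end BinaryTensor

end

open MeasureTheory ProbabilityTheory

namespace BinaryTensor

/-! The log-likelihood at the maximizer is at least that at the truth, and their difference is a
centred noise term, linear in the increments of `logit ∘ f`, minus a sum of Bernoulli divergences.
In the natural parameter the divergence dominates a quadratic (`logit_sub_sq_le_bernoulliKL`), so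
with γ = m l² / 2 the squared Frobenius error times γ is at most the noise
(`IsConstrainedMLE.basic_inequality`). Half of this curvature is kept as a penalty, the other half
pays for the tail.

The exponential moment of the penalized noise is compared, one coordinate at a time, with that of a
Rademacher process linear in Θ̂ - Θ (`bernoulli_sup_le_rademacher_sup`); contraction removes `logit
∘ f` at the cost of its Lipschitz constant L. A difference of two rank-R tensors is a sum of 2R
rank-one terms, so the linear process is at most the spectral norm of the sign tensor times
√((2R)^(K-1)) times the Frobenius error (`sum_mul_le_of_multiForm_le`). Completing the square
against the penalty leaves a multiple of the squared spectral norm, which a product net of at most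
5^(∑ d_k) points reduces to scalar subgaussian sums.

Hence the error is of order L / (m l²) · √(R^(K-1) ∑ d_k) (`measureReal_error_gt_le`), and
`exists_linkRegular` bounds L / (m l²) by a multiple of C(α, σ) for each link. -/

/-! ### Symmetrization and contraction of Bernoulli noise. -/

/-- Weak majorization for an increasing convex function. Raising `a` to `a' + b' - b` makes the sums
equal, and the gap times `exp b` then factors as (e^a' - e^b)(e^b - e^b'). -/
theorem exp_add_exp_le_of_majorized {a b a' b' : ℝ} (ha : a ≤ max a' b') (hb : b ≤ max a' b')
    (hab : a + b ≤ a' + b') : Real.exp a + Real.exp b ≤ Real.exp a' + Real.exp b' := by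
  wlog h : b' ≤ a' generalizing a' b'
  · have := this (a' := b') (b' := a') (by rwa [max_comm]) (by rwa [max_comm]) (by linarith)
      (le_of_not_ge h)
    linarith
  rw [max_eq_left h] at ha hb
  rcases le_or_gt b b' with hb' | hb'
  · exact add_le_add (Real.exp_le_exp.2 ha) (Real.exp_le_exp.2 hb')
  have h1 : Real.exp a ≤ Real.exp (a' + b' - b) := Real.exp_le_exp.2 (by linarith)
  have h2 : Real.exp (a' + b' - b) * Real.exp b = Real.exp a' * Real.exp b' := by
    rw [← Real.exp_add, ← Real.exp_add]; congr 1; ring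
  have h3 : Real.exp b ≤ Real.exp a' := Real.exp_le_exp.2 hb
  have h4 : Real.exp b' ≤ Real.exp b := Real.exp_le_exp.2 hb'.le
  have h5 : (Real.exp a' + Real.exp b' - Real.exp (a' + b' - b) - Real.exp b) * Real.exp b
      = (Real.exp a' - Real.exp b) * (Real.exp b - Real.exp b') := by
    linear_combination -h2
  have h6 : 0 ≤ (Real.exp a' + Real.exp b' - Real.exp (a' + b' - b) - Real.exp b) :=
    nonneg_of_mul_nonneg_left (h5 ▸ mul_nonneg (sub_nonneg.2 h3) (sub_nonneg.2 h4))
      (Real.exp_pos b)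
  linarith

theorem le_iSup_of_finite {τ : Type*} [Finite τ] (g : τ → ℝ) (t : τ) : g t ≤ ⨆ t, g t :=
  le_ciSup (Set.finite_range g).bddAbove t

/-- The two-point contraction principle. -/
theorem exp_iSup_contraction {τ : Type*} [Finite τ] [Nonempty τ]
    (u a b : τ → ℝ) (hab : ∀ t s, |a t - a s| ≤ |b t - b s|)
    (h0 : ∀ t, |a t| ≤ |b t|) :
    Real.exp (⨆ t, (u + a) t) + Real.exp (⨆ t, (u - a) t) ≤
      Real.exp (⨆ t, (u + b) t) + Real.exp (⨆ t, (u - b) t) := by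
  -- With `t` and `s` attaining the two suprema, `h0` bounds each exponent by the larger supremum on
  -- the right, and `hab` bounds their sum by the sum of both: weak majorization.
  obtain ⟨t, ht⟩ := exists_eq_ciSup_of_finite (f := u + a)
  obtain ⟨s, hs⟩ := exists_eq_ciSup_of_finite (f := u - a)
  rw [← ht, ← hs]
  have hp := fun t => le_iSup_of_finite (u + b) t
  have hm := fun t => le_iSup_of_finite (u - b) t
  simp only [Pi.add_apply, Pi.sub_apply] at hp hm ⊢
  have key : ∀ t, u t + |b t| ≤ max (⨆ t, (u t + b t)) (⨆ t, (u t - b t)) := by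
    intro t
    rcases abs_cases (b t) with h | h
    · exact le_max_of_le_left (by rw [h.1]; exact hp t)
    · exact le_max_of_le_right (by rw [h.1, ← sub_eq_add_neg]; exact hm t)
  refine exp_add_exp_le_of_majorized ?_ ?_ ?_
  · linarith [key t, h0 t, le_abs_self (a t)]
  · linarith [key s, h0 s, neg_abs_le (a s)]
  · have h1 := (le_abs_self _).trans (hab t s)
    rcases abs_cases (b t - b s) with h | h
    · linarith [hp t, hm s]
    · linarith [hp s, hm t]

/-- Symmetrization of a centred Bernoulli variable. -/
theorem exp_iSup_symmetrization {τ : Type*} [Finite τ] [Nonempty τ]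
    {p : ℝ} (hp0 : 0 ≤ p) (hp1 : p ≤ 1) (u a : τ → ℝ) :
    p * Real.exp (⨆ t, (u + (1 - p) • a) t) + (1 - p) * Real.exp (⨆ t, (u + (-p) • a) t) ≤
      (1 / 2) * (Real.exp (⨆ t, (u + a) t) + Real.exp (⨆ t, (u - a) t)) := by
  obtain ⟨t, ht⟩ := exists_eq_ciSup_of_finite (f := u + (1 - p) • a)
  obtain ⟨s, hs⟩ := exists_eq_ciSup_of_finite (f := u + (-p) • a)
  rw [← ht, ← hs]
  have hP := fun t => Real.exp_le_exp.2 (le_iSup_of_finite (u + a) t)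
  have hN := fun t => Real.exp_le_exp.2 (le_iSup_of_finite (u - a) t)
  set P := Real.exp (⨆ t, (u + a) t)
  set N := Real.exp (⨆ t, (u - a) t)
  simp only [Pi.add_apply, Pi.sub_apply, Pi.smul_apply, smul_eq_mul] at hP hN ⊢
  have conv : ∀ x y : ℝ, ∀ q : ℝ, 0 ≤ q → q ≤ 1 →
      Real.exp ((1 - q) * x + q * y) ≤ (1 - q) * Real.exp x + q * Real.exp y := by
    intro x y q h0 h1
    have := convexOn_exp.2 (Set.mem_univ x) (Set.mem_univ y) (sub_nonneg.2 h1) h0 (by ring)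
    simpa using this
  -- `u` is the midpoint of `u + a` and `u - a`; the shifted exponents below lie between `u` and one
  -- of these.
  have hU : ∀ t, Real.exp (u t) ≤ (P + N) / 2 := by
    intro t
    have := conv (u t + a t) (u t - a t) (1 / 2) (by norm_num) (by norm_num)
    rw [show (1 - 1 / 2) * (u t + a t) + 1 / 2 * (u t - a t) = u t by ring] at this
    linarith [hP t, hN t]
  have h1 : Real.exp (u t + (1 - p) * a t) ≤ p * ((P + N) / 2) + (1 - p) * P := by
    have := conv (u t) (u t + a t) (1 - p) (by linarith) (by linarith)
    rw [show (1 - (1 - p)) * u t + (1 - p) * (u t + a t) = u t + (1 - p) * a t by ring] at this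
    nlinarith [hP t, hU t]
  have h2 : Real.exp (u s + -p * a s) ≤ (1 - p) * ((P + N) / 2) + p * N := by
    have := conv (u s) (u s - a s) p hp0 hp1
    rw [show (1 - p) * u s + p * (u s - a s) = u s + -p * a s by ring] at this
    nlinarith [hN s, hU s]
  -- The weights add up to p² + 2p(1 - p) + (1 - p)² = 1, so symmetrization does not double the
  -- process.
  calc _ ≤ p * (p * ((P + N) / 2) + (1 - p) * P) +
        (1 - p) * ((1 - p) * ((P + N) / 2) + p * N) :=
        add_le_add (mul_le_mul_of_nonneg_left h1 hp0)
          (mul_le_mul_of_nonneg_left h2 (by linarith))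
    _ = _ := by ring

/-- Lindeberg-style replacement: since the one-coordinate comparison holds for every offset `u`, the
other coordinates can be frozen into the offset while one is exchanged. -/
theorem sum_prod_le_of_coordinatewise_fin {τ : Type*} {n : ℕ} (w w' : Fin n → Bool → ℝ)
    (hw : ∀ i b, 0 ≤ w i b) (hw' : ∀ i b, 0 ≤ w' i b) (g g' : Fin n → Bool → τ → ℝ)
    (F : (τ → ℝ) → ℝ)
    (h : ∀ i u, ∑ b, w i b * F (u + g i b) ≤ ∑ b, w' i b * F (u + g' i b)) (u : τ → ℝ) :
    ∑ y : Fin n → Bool, (∏ i, w i (y i)) * F (u + ∑ i, g i (y i)) ≤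
      ∑ y : Fin n → Bool, (∏ i, w' i (y i)) * F (u + ∑ i, g' i (y i)) := by
  induction n generalizing u with
  | zero => simp
  | succ n ih =>
    have split : ∀ (w : Fin (n + 1) → Bool → ℝ) (g : Fin (n + 1) → Bool → τ → ℝ),
        ∑ y : Fin (n + 1) → Bool, (∏ i, w i (y i)) * F (u + ∑ i, g i (y i)) =
          ∑ b, w 0 b * ∑ y : Fin n → Bool, (∏ i, w i.succ (y i)) *
            F ((u + g 0 b) + ∑ i, g i.succ (y i)) := by
      intro w g
      rw [← (Fin.consEquiv fun _ => Bool).sum_comp, Fintype.sum_prod_type]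
      refine Finset.sum_congr rfl fun b _ => ?_
      rw [Finset.mul_sum]
      refine Finset.sum_congr rfl fun y _ => ?_
      simp [Fin.consEquiv, Fin.prod_univ_succ, Fin.sum_univ_succ, mul_assoc, add_assoc]
    rw [split, split]
    calc _ ≤ ∑ b, w 0 b * ∑ y : Fin n → Bool, (∏ i, w' i.succ (y i)) *
            F ((u + g 0 b) + ∑ i, g' i.succ (y i)) :=
          Finset.sum_le_sum fun b _ => mul_le_mul_of_nonneg_left
            (ih _ _ (fun _ => hw _) (fun _ => hw' _) _ _ (fun i => h _) _) (hw 0 b)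
      _ = ∑ y : Fin n → Bool, (∏ i, w' i.succ (y i)) *
            ∑ b, w 0 b * F ((u + ∑ i, g' i.succ (y i)) + g 0 b) := by
          simp_rw [Finset.mul_sum]
          rw [Finset.sum_comm]
          refine Finset.sum_congr rfl fun y _ => Finset.sum_congr rfl fun b _ => ?_
          rw [add_right_comm]; ring
      _ ≤ ∑ y : Fin n → Bool, (∏ i, w' i.succ (y i)) *
            ∑ b, w' 0 b * F ((u + ∑ i, g' i.succ (y i)) + g' 0 b) :=
          Finset.sum_le_sum fun y _ => mul_le_mul_of_nonneg_left (h 0 _)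
            (Finset.prod_nonneg fun i _ => hw' _ _)
      _ = _ := by
          simp_rw [Finset.mul_sum]
          rw [Finset.sum_comm]
          refine Finset.sum_congr rfl fun y _ => Finset.sum_congr rfl fun b _ => ?_
          rw [add_right_comm]; ring

theorem sum_prod_le_of_coordinatewise {τ ι : Type*} [Fintype ι] [DecidableEq ι]
    (w w' : ι → Bool → ℝ)
    (hw : ∀ i b, 0 ≤ w i b) (hw' : ∀ i b, 0 ≤ w' i b) (g g' : ι → Bool → τ → ℝ)
    (F : (τ → ℝ) → ℝ)
    (h : ∀ i u, ∑ b, w i b * F (u + g i b) ≤ ∑ b, w' i b * F (u + g' i b)) (u : τ → ℝ) :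
    ∑ y : ι → Bool, (∏ i, w i (y i)) * F (u + ∑ i, g i (y i)) ≤
      ∑ y : ι → Bool, (∏ i, w' i (y i)) * F (u + ∑ i, g' i (y i)) := by
  let e := (Fintype.equivFin ι).symm
  have reindex : ∀ (w : ι → Bool → ℝ) (g : ι → Bool → τ → ℝ),
      ∑ y : ι → Bool, (∏ i, w i (y i)) * F (u + ∑ i, g i (y i)) =
        ∑ y : Fin (Fintype.card ι) → Bool, (∏ i, w (e i) (y i)) *
          F (u + ∑ i, g (e i) (y i)) := by
    intro w g
    rw [← (Equiv.arrowCongr e (Equiv.refl Bool)).sum_comp]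
    refine Finset.sum_congr rfl fun y _ => ?_
    rw [← e.prod_comp, ← e.sum_comp]
    simp
  rw [reindex, reindex]
  exact sum_prod_le_of_coordinatewise_fin _ _ (fun _ => hw _) (fun _ => hw' _) _ _ F
    (fun _ => h _) u

/-- Symmetrization and contraction, for exponential moments of a supremum with an offset: the
centred Bernoulli process on the left is dominated by the Rademacher process on the right. -/
theorem bernoulli_sup_le_rademacher_sup {τ ι : Type*} [Finite τ] [Nonempty τ]
    [Fintype ι] [DecidableEq ι] (p : ι → ℝ)
    (hp0 : ∀ i, 0 ≤ p i) (hp1 : ∀ i, p i ≤ 1) (u : τ → ℝ) (a b : ι → τ → ℝ)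
    (hab : ∀ i t s, |a i t - a i s| ≤ |b i t - b i s|) (h0 : ∀ i t, |a i t| ≤ |b i t|) :
    ∑ y : ι → Bool, (∏ i, if y i then p i else 1 - p i) *
        Real.exp (⨆ t, (u t + ∑ i, ((if y i then 1 else 0) - p i) * a i t)) ≤
      ∑ y : ι → Bool, (∏ _i : ι, (1 / 2 : ℝ)) *
        Real.exp (⨆ t, (u t + ∑ i, (if y i then 1 else -1) * b i t)) := by
  have := sum_prod_le_of_coordinatewise (fun i c => if c then p i else 1 - p i)
    (fun _ _ => 1 / 2) (fun i c => by cases c <;> simp [hp0, hp1]) (fun _ _ => by norm_num)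
    (fun i c => ((if c then 1 else 0) - p i) • a i) (fun i c => (if c then (1 : ℝ) else -1) • b i)
    (fun v : τ → ℝ => Real.exp (⨆ t, v t)) ?_ u
  · simpa only [Pi.add_apply, Finset.sum_apply, Pi.smul_apply, smul_eq_mul] using this
  · intro i v
    have h1 := exp_iSup_symmetrization (hp0 i) (hp1 i) v (a i)
    have h2 := exp_iSup_contraction v (a i) (b i) (hab i) (h0 i)
    simp only [Fintype.univ_bool, Finset.mem_singleton, Bool.true_eq_false, not_false_eq_true,
      Finset.sum_insert, Finset.sum_singleton, if_true, Bool.false_eq_true, if_false, zero_sub,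
      one_smul, neg_one_smul, ← sub_eq_add_neg]
    linarith

/-! ### Nets and the spectral norm. -/

/-- A `1/2`-net of the Euclidean unit ball, in the form in which it controls linear forms. -/
theorem exists_norming_finset (n : ℕ) :
    ∃ N : Finset (EuclideanSpace ℝ (Fin n)), N.card ≤ 5 ^ n ∧ (∀ x ∈ N, ‖x‖ ≤ 1) ∧
      ∀ v, ∃ x ∈ N, ‖v‖ ≤ 2 * inner ℝ v x := by
  classical
  let E := EuclideanSpace ℝ (Fin n)
  -- A maximal 1-separated family in the ball of radius 2 is a 1-net of it; volume comparison bounds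
  -- its size by 5^n. Halving it gives the required set.
  let P : Finset E → Prop := fun s => (∀ c ∈ s, ‖c‖ ≤ 2) ∧ ∀ c ∈ s, ∀ d ∈ s, c ≠ d → 1 ≤ ‖c - d‖
  have hcard : ∀ s, P s → s.card ≤ 5 ^ n := by
    intro s hs
    simpa only [E, finrank_euclideanSpace_fin] using Besicovitch.card_le_of_separated s hs.1 hs.2
  obtain ⟨s, hs, hmax⟩ : ∃ s, P s ∧ ∀ t, P t → t.card ≤ s.card := by
    have hne : {m | ∃ s, P s ∧ s.card = m}.Nonempty := ⟨0, ∅, by simp [P], rfl⟩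
    have hb : BddAbove {m | ∃ s, P s ∧ s.card = m} :=
      ⟨5 ^ n, by rintro m ⟨s, hs, rfl⟩; exact hcard s hs⟩
    obtain ⟨s, hs, h⟩ := Nat.sSup_mem hne hb
    exact ⟨s, hs, fun t ht => h ▸ le_csSup hb ⟨t, ht, rfl⟩⟩
  have hnet : ∀ x : E, ‖x‖ ≤ 2 → ∃ c ∈ s, ‖x - c‖ ≤ 1 := by
    intro x hx
    by_contra! hcon
    have hxs : x ∉ s := fun h => by
      have := hcon x h
      rw [sub_self, norm_zero] at this
      linarith
    have hP : P (insert x s) := by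
      refine ⟨?_, ?_⟩
      · intro c hc
        rcases Finset.mem_insert.1 hc with rfl | hc
        exacts [hx, hs.1 c hc]
      · intro c hc d hd hcd
        rcases Finset.mem_insert.1 hc with hcx | hcs <;>
          rcases Finset.mem_insert.1 hd with hdx | hds
        · exact absurd (hcx.trans hdx.symm) hcd
        · rw [hcx]; exact (hcon d hds).le
        · rw [hdx, norm_sub_rev]; exact (hcon c hcs).le
        · exact hs.2 c hcs d hds hcd
    have := hmax _ hP
    rw [Finset.card_insert_of_notMem hxs] at this
    omega
  refine ⟨s.image fun c => (1 / 2 : ℝ) • c, Finset.card_image_le.trans (hcard s hs), ?_, ?_⟩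
  · intro x hx
    obtain ⟨c, hc, rfl⟩ := Finset.mem_image.1 hx
    rw [norm_smul, Real.norm_of_nonneg (by norm_num)]
    linarith [hs.1 c hc]
  · intro v
    -- The witness is 2v/‖v‖; moving it to a net point at distance at most 1 costs at most ‖v‖ of
    -- the inner product 2‖v‖.
    obtain ⟨x, hx, hvx⟩ : ∃ x : E, ‖x‖ ≤ 2 ∧ 2 * ‖v‖ ≤ inner ℝ v x := by
      rcases eq_or_ne v 0 with rfl | hv
      · exact ⟨0, by simp, by simp⟩
      · have hv' : ‖v‖ ≠ 0 := norm_ne_zero_iff.2 hv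
        refine ⟨(2 / ‖v‖) • v, ?_, ?_⟩
        · rw [norm_smul, Real.norm_of_nonneg (by positivity), div_mul_cancel₀ _ hv']
        · rw [inner_smul_right, real_inner_self_eq_norm_sq]
          field_simp
          exact le_rfl
    obtain ⟨c, hc, hxc⟩ := hnet x hx
    refine ⟨_, Finset.mem_image_of_mem _ hc, ?_⟩
    rw [inner_smul_right]
    have h1 : inner ℝ v (x - c) ≤ ‖v‖ * ‖x - c‖ := real_inner_le_norm _ _
    rw [inner_sub_right] at h1
    have h2 : ‖v‖ * ‖x - c‖ ≤ ‖v‖ * 1 := mul_le_mul_of_nonneg_left hxc (norm_nonneg v)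
    linarith

/-- The multilinear form with coefficient tensor `ε`. -/
def multiForm {K : ℕ} {d : Fin K → ℕ} (ε : RealTensor d)
    (x : (k : Fin K) → EuclideanSpace ℝ (Fin (d k))) : ℝ :=
  ∑ i, ε i * ∏ k, x k (i k)

theorem sum_idx_succ {K : ℕ} {d : Fin (K + 1) → ℕ} (g : Idx d → ℝ) :
    ∑ i, g i = ∑ l, ∑ i' : Idx (fun k => d (Fin.succ k)), g (Fin.cons l i') := by
  rw [← (Fin.consEquiv fun k => Fin (d k)).sum_comp, Fintype.sum_prod_type]
  rfl

/-- Contraction of the first mode of a tensor with a vector. -/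
def contractFirst {K : ℕ} {d : Fin (K + 1) → ℕ} (ε : RealTensor d)
    (v : EuclideanSpace ℝ (Fin (d 0))) : RealTensor (fun k : Fin K => d k.succ) :=
  fun i' => ∑ l, v l * ε (Fin.cons l i')

theorem multiForm_succ {K : ℕ} {d : Fin (K + 1) → ℕ} (ε : RealTensor d)
    (x : (k : Fin (K + 1)) → EuclideanSpace ℝ (Fin (d k))) :
    multiForm ε x = multiForm (contractFirst ε (x 0)) (fun k => x k.succ) := by
  unfold multiForm contractFirst
  rw [sum_idx_succ, Finset.sum_comm]
  refine Finset.sum_congr rfl fun i' _ => ?_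
  rw [Finset.sum_mul]
  refine Finset.sum_congr rfl fun l _ => ?_
  rw [Fin.prod_univ_succ]
  simp only [Fin.cons_zero, Fin.cons_succ]
  ring

theorem multiForm_succ_eq_inner {K : ℕ} {d : Fin (K + 1) → ℕ} (ε : RealTensor d)
    (x : (k : Fin (K + 1)) → EuclideanSpace ℝ (Fin (d k))) :
    multiForm ε x = inner ℝ (WithLp.toLp 2 fun l =>
      multiForm (fun i' => ε (Fin.cons l i')) (fun k => x k.succ)) (x 0) := by
  unfold multiForm
  rw [sum_idx_succ, PiLp.inner_apply]
  refine Finset.sum_congr rfl fun l _ => ?_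
  simp only [RCLike.inner_apply, conj_trivial]
  rw [Finset.mul_sum]
  refine Finset.sum_congr rfl fun i' _ => ?_
  rw [Fin.prod_univ_succ]
  simp only [Fin.cons_zero, Fin.cons_succ]
  ring

/-- The spectral norm is controlled by a product of nets. -/
theorem exists_multiForm_le_net {K : ℕ} {d : Fin K → ℕ}
    (N : (k : Fin K) → Finset (EuclideanSpace ℝ (Fin (d k))))
    (hN : ∀ k v, ∃ x ∈ N k, ‖v‖ ≤ 2 * inner ℝ v x) (ε : RealTensor d)
    (x : (k : Fin K) → EuclideanSpace ℝ (Fin (d k))) (hx : ∀ k, ‖x k‖ ≤ 1) :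
    ∃ y ∈ Fintype.piFinset N, multiForm ε x ≤ 2 ^ K * multiForm ε y := by
  induction K with
  | zero => exact ⟨x, Fintype.mem_piFinset.2 (fun k => k.elim0), by simp⟩
  | succ K ih =>
    -- With the other modes frozen, the form is the inner product of the first argument with `v`.
    -- Each mode moved into its net costs a factor 2; the induction hypothesis applies after the
    -- first mode is already at `y₀`.
    let v : EuclideanSpace ℝ (Fin (d 0)) := WithLp.toLp 2 fun l =>
      multiForm (fun i' => ε (Fin.cons l i')) (fun k => x k.succ)
    obtain ⟨y₀, hy₀, hv⟩ := hN 0 v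
    obtain ⟨y', hy', h'⟩ := ih (fun k => N k.succ) (fun k => hN k.succ) (contractFirst ε y₀)
      (fun k => x k.succ) (fun k => hx k.succ)
    refine ⟨Fin.cons y₀ y', ?_, ?_⟩
    · rw [Fintype.mem_piFinset]
      intro k
      refine Fin.cases ?_ (fun k => ?_) k
      · simpa using hy₀
      · simpa using Fintype.mem_piFinset.1 hy' k
    · have h1 : multiForm ε x ≤ ‖v‖ := by
        rw [multiForm_succ_eq_inner]
        exact (real_inner_le_norm _ _).trans
          (mul_le_of_le_one_right (norm_nonneg _) (hx 0))
      have h2 : inner ℝ v y₀ = multiForm (contractFirst ε y₀) (fun k => x k.succ) := by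
        have h3 := multiForm_succ_eq_inner ε (Fin.cons y₀ fun k => x k.succ)
        rw [multiForm_succ] at h3
        simpa [v] using h3.symm
      have h3 : multiForm ε (Fin.cons y₀ y') = multiForm (contractFirst ε y₀) y' := by
        rw [multiForm_succ]; simp
      rw [h3, pow_succ]
      linarith

/-! ### Duality between spectral and Frobenius norms at low rank. -/

theorem sum_sq_prod_eq {K : ℕ} {d : Fin K → ℕ}
    (x : (k : Fin K) → EuclideanSpace ℝ (Fin (d k))) :
    ∑ i : Idx d, (∏ k, x k (i k)) ^ 2 = ∏ k, ‖x k‖ ^ 2 := by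
  simp_rw [EuclideanSpace.norm_sq_eq, Real.norm_eq_abs, sq_abs, Finset.prod_univ_sum,
    Fintype.piFinset_univ, Finset.prod_pow]

/-- Duality between the spectral norm and a sum of `ρ` rank-one terms. -/
theorem sum_mul_le_of_multiForm_le {K : ℕ} {d : Fin (K + 1) → ℕ} {ρ : Type*} [Fintype ρ]
    (c : ρ → ℝ) (a : ρ → (k : Fin (K + 1)) → EuclideanSpace ℝ (Fin (d k))) (T ε : RealTensor d)
    (hT : ∀ i, T i = ∑ r, c r * ∏ k, a r k (i k)) {s : ℝ}
    (hs : ∀ x, (∀ k, ‖x k‖ ≤ 1) → multiForm ε x ≤ s) :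
    ∑ i, ε i * T i ≤ s * Real.sqrt ((Fintype.card ρ : ℝ) ^ K) * Real.sqrt (∑ i, T i ^ 2) := by
  have hs0 : 0 ≤ s := by
    have := hs 0 (by simp)
    rw [multiForm_succ_eq_inner] at this
    simpa using this
  induction K generalizing c with
  | zero =>
    let v : EuclideanSpace ℝ (Fin (d 0)) := WithLp.toLp 2 fun l => T (Fin.cons l finZeroElim)
    have hsum : ∀ g : Idx d → ℝ, ∑ i, g i = ∑ l, g (Fin.cons l finZeroElim) := by
      intro g
      rw [sum_idx_succ]
      refine Finset.sum_congr rfl fun l _ => ?_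
      rw [Fintype.sum_unique]
      congr
    have hv : Real.sqrt (∑ i, T i ^ 2) = ‖v‖ := by
      rw [hsum, EuclideanSpace.norm_eq]
      simp [v]
    have hform : ∀ x : (k : Fin 1) → EuclideanSpace ℝ (Fin (d k)),
        multiForm ε x = ∑ l, ε (Fin.cons l finZeroElim) * x 0 l := by
      intro x
      unfold multiForm
      rw [hsum]
      simp
    rw [hv, pow_zero, Real.sqrt_one, mul_one, hsum]
    rcases eq_or_ne v 0 with h0 | h0
    · have : ∀ l, T (Fin.cons l finZeroElim) = 0 := fun l => by
        simpa [v] using congrArg (fun w : EuclideanSpace ℝ (Fin (d 0)) => w l) h0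
      simp [this, h0]
    · have hn : 0 < ‖v‖ := norm_pos_iff.2 h0
      -- For one mode this is Euclidean duality, without loss: test the form on the normalized
      -- tensor.
      have := hs (Fin.cons (‖v‖⁻¹ • v) finZeroElim) (by
        intro k
        refine Fin.cases ?_ (fun k => k.elim0) k
        rw [Fin.cons_zero, norm_smul, norm_inv, norm_norm, inv_mul_cancel₀ hn.ne'])
      rw [hform] at this
      simp only [Fin.cons_zero, PiLp.smul_apply, smul_eq_mul] at this
      calc _ = (∑ l, ε (Fin.cons l finZeroElim) * (‖v‖⁻¹ * v l)) * ‖v‖ := by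
            rw [Finset.sum_mul]
            refine Finset.sum_congr rfl fun l _ => ?_
            have h1 : ‖v‖⁻¹ * ‖v‖ = 1 := inv_mul_cancel₀ hn.ne'
            linear_combination -(ε (Fin.cons l finZeroElim) * v l) * h1
        _ ≤ _ := mul_le_mul_of_nonneg_right this hn.le
  | succ K ih =>
    -- All mode-one fibres of `T` lie in this span, of dimension at most |ρ|. Expanding in an
    -- orthonormal basis splits the pairing into at most |ρ| pairings with one mode fewer.
    let U : Submodule ℝ (EuclideanSpace ℝ (Fin (d 0))) := Submodule.span ℝ (Set.range fun r => a r 0)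
    let b := stdOrthonormalBasis ℝ U
    let J := Fin (Module.finrank ℝ U)
    let u : J → EuclideanSpace ℝ (Fin (d 0)) := fun j => (b j : EuclideanSpace ℝ (Fin (d 0)))
    have hu : Orthonormal ℝ u := b.orthonormal.comp_linearIsometry U.subtypeₗᵢ
    have hcard : (Module.finrank ℝ U : ℝ) ≤ Fintype.card ρ := by
      exact_mod_cast finrank_range_le_card _
    have hmem : ∀ r, a r 0 ∈ U := fun r => Submodule.subset_span ⟨r, rfl⟩
    have hexp : ∀ v ∈ U, ∀ l, v l = ∑ j, inner ℝ (u j) v * u j l := by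
      intro v hv l
      have := congrArg (fun w : U => (w : EuclideanSpace ℝ (Fin (d 0))) l)
        (b.sum_repr' ⟨v, hv⟩)
      simpa [u] using this.symm
    let fib : Idx (fun k : Fin (K + 1) => d k.succ) → EuclideanSpace ℝ (Fin (d 0)) :=
      fun i' => WithLp.toLp 2 fun l => T (Fin.cons l i')
    have hfib : ∀ i', fib i' ∈ U := by
      intro i'
      have : fib i' = ∑ r, (c r * ∏ k : Fin (K + 1), a r k.succ (i' k)) • a r 0 := by
        ext l
        simp only [fib, hT, Fin.prod_univ_succ (n := K + 1), Fin.cons_zero, Fin.cons_succ]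
        simp only [WithLp.ofLp_sum, WithLp.ofLp_smul, Finset.sum_apply, Pi.smul_apply, smul_eq_mul]
        exact Finset.sum_congr rfl fun r _ => by ring
      rw [this]
      exact Submodule.sum_mem _ fun r _ => U.smul_mem _ (hmem r)
    have hin : ∀ j i', inner ℝ (u j) (fib i') = contractFirst T (u j) i' := by
      intro j i'
      simp only [PiLp.inner_apply, fib, contractFirst, RCLike.inner_apply, conj_trivial]
      exact Finset.sum_congr rfl fun l _ => mul_comm _ _
    have key : ∀ j, ∑ i', contractFirst ε (u j) i' * contractFirst T (u j) i' ≤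
        s * Real.sqrt ((Fintype.card ρ : ℝ) ^ K) *
          Real.sqrt (∑ i', contractFirst T (u j) i' ^ 2) := by
      intro j
      -- Contraction keeps the same number of rank-one terms and only changes the coefficients,
      -- which is why `c` carries no sign condition.
      refine ih (fun r => c r * inner ℝ (u j) (a r 0)) (fun r k => a r k.succ)
        (contractFirst T (u j)) (contractFirst ε (u j)) ?_ ?_
      · intro i'
        simp only [contractFirst, hT, Fin.prod_univ_succ (n := K + 1), Fin.cons_zero,
          Fin.cons_succ, PiLp.inner_apply, RCLike.inner_apply, conj_trivial]
        simp_rw [Finset.mul_sum, Finset.sum_mul]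
        rw [Finset.sum_comm]
        exact Finset.sum_congr rfl fun r _ => Finset.sum_congr rfl fun l _ => by ring
      · intro x hx
        have := hs (Fin.cons (u j) x) (by
          intro k
          refine Fin.cases ?_ (fun k => ?_) k
          · simp [hu.1 j]
          · simpa using hx k)
        rw [multiForm_succ] at this
        simpa using this
    have hsplit : ∑ i, ε i * T i =
        ∑ j, ∑ i', contractFirst ε (u j) i' * contractFirst T (u j) i' := by
      rw [sum_idx_succ, Finset.sum_comm, Finset.sum_comm (s := Finset.univ (α := J))]
      refine Finset.sum_congr rfl fun i' _ => ?_
      have : ∀ l, T (Fin.cons l i') = ∑ j, contractFirst T (u j) i' * u j l := by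
        intro l
        simp_rw [← hin]
        exact hexp _ (hfib i') l
      simp_rw [this, contractFirst, Finset.mul_sum]
      simp_rw [Finset.sum_mul, Finset.mul_sum]
      rw [Finset.sum_comm]
      refine Finset.sum_congr rfl fun j _ => ?_
      rw [Finset.sum_comm]
      exact Finset.sum_congr rfl fun l _ => Finset.sum_congr rfl fun l' _ => by ring
    have hbessel : ∑ j, ∑ i', contractFirst T (u j) i' ^ 2 ≤ ∑ i, T i ^ 2 := by
      rw [sum_idx_succ, Finset.sum_comm, Finset.sum_comm (s := Finset.univ (α := Fin (d 0)))]
      refine Finset.sum_le_sum fun i' _ => ?_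
      have h1 := hu.sum_inner_products_le (fib i') (s := Finset.univ)
      simp_rw [Real.norm_eq_abs, sq_abs, hin] at h1
      refine h1.trans (le_of_eq ?_)
      rw [EuclideanSpace.norm_sq_eq]
      simp [fib]
    -- Cauchy–Schwarz over the basis costs √|ρ|, once for each mode except the last.
    have hCS : ∑ j, Real.sqrt (∑ i', contractFirst T (u j) i' ^ 2) ≤
        Real.sqrt (Fintype.card ρ) * Real.sqrt (∑ i, T i ^ 2) := by
      rw [← Real.sqrt_mul (Nat.cast_nonneg _)]
      refine Real.le_sqrt_of_sq_le ?_
      refine (sq_sum_le_card_mul_sum_sq (s := Finset.univ)).trans ?_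
      rw [Finset.card_univ, Fintype.card_fin]
      refine mul_le_mul hcard ?_ (Finset.sum_nonneg fun _ _ => sq_nonneg _) (Nat.cast_nonneg _)
      refine le_trans (le_of_eq ?_) hbessel
      exact Finset.sum_congr rfl fun j _ => Real.sq_sqrt (Finset.sum_nonneg fun _ _ => sq_nonneg _)
    calc _ ≤ ∑ j, s * Real.sqrt ((Fintype.card ρ : ℝ) ^ K) *
          Real.sqrt (∑ i', contractFirst T (u j) i' ^ 2) := by
          rw [hsplit]; exact Finset.sum_le_sum fun j _ => key j
      _ ≤ s * Real.sqrt ((Fintype.card ρ : ℝ) ^ K) *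
          (Real.sqrt (Fintype.card ρ) * Real.sqrt (∑ i, T i ^ 2)) := by
          rw [← Finset.mul_sum]
          exact mul_le_mul_of_nonneg_left hCS (by positivity)
      _ = _ := by
          rw [pow_succ, Real.sqrt_mul (by positivity)]; ring

/-! ### Exponential moments of Rademacher sums. -/

theorem rademacher_mgf_le {ι : Type*} [Fintype ι] [DecidableEq ι] (c : ι → ℝ)
    (hc : ∑ i, c i ^ 2 ≤ 1) (t : ℝ) :
    ∑ y : ι → Bool, (∏ _i : ι, (1 / 2 : ℝ)) *
      Real.exp (t * ∑ i, (if y i then 1 else -1) * c i) ≤ Real.exp (t ^ 2 / 2) := by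
  calc _ = ∏ i, Real.cosh (t * c i) := by
        have : ∀ i, Real.cosh (t * c i) =
            ∑ b : Bool, (1 / 2) * Real.exp (t * ((if b then 1 else -1) * c i)) := by
          intro i
          rw [Real.cosh_eq]
          simp
          ring
        simp_rw [this]
        rw [Finset.prod_univ_sum, Fintype.piFinset_univ]
        refine Finset.sum_congr rfl fun y _ => ?_
        rw [Finset.prod_mul_distrib, ← Real.exp_sum, Finset.mul_sum]
    _ ≤ ∏ i, Real.exp ((t * c i) ^ 2 / 2) :=
        Finset.prod_le_prod (fun i _ => (Real.cosh_pos _).le)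
          fun i _ => Real.cosh_le_exp_half_sq _
    _ = Real.exp (t ^ 2 / 2 * ∑ i, c i ^ 2) := by
        rw [← Real.exp_sum, Finset.mul_sum]
        congr 1
        exact Finset.sum_congr rfl fun i _ => by ring
    _ ≤ _ := Real.exp_le_exp.2 (mul_le_of_le_one_right (by positivity) hc)

theorem integral_exp_mul_gaussian (z : ℝ) :
    ∫ x, Real.exp (z * x) ∂(gaussianReal 0 1) = Real.exp (z ^ 2 / 2) := by
  have := congrFun (mgf_id_gaussianReal (μ := 0) (v := 1)) z
  simpa [mgf] using this

theorem gaussian_exp_quarter_sq :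
    Integrable (fun x : ℝ => Real.exp (x ^ 2 / 4)) (gaussianReal 0 1) ∧
      ∫ x, Real.exp (x ^ 2 / 4) ∂(gaussianReal 0 1) = Real.sqrt 2 := by
  have hpdf : ∀ x : ℝ, gaussianPDFReal 0 1 x • Real.exp (x ^ 2 / 4) =
      (Real.sqrt (2 * Real.pi))⁻¹ * Real.exp (-(1 / 4) * x ^ 2) := by
    intro x
    rw [gaussianPDFReal, smul_eq_mul, mul_assoc, ← Real.exp_add]
    simp only [NNReal.coe_one, mul_one, sub_zero]
    congr 2
    ring
  constructor
  · rw [gaussianReal_of_var_ne_zero _ one_ne_zero,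
      integrable_withDensity_iff_integrable_smul' (measurable_gaussianPDF _ _)
        (Filter.Eventually.of_forall fun x => gaussianPDF_lt_top)]
    simp_rw [toReal_gaussianPDF, hpdf]
    exact (integrable_exp_neg_mul_sq (by norm_num)).const_mul _
  · rw [integral_gaussianReal_eq_integral_smul one_ne_zero]
    simp_rw [hpdf]
    rw [integral_const_mul, integral_gaussian, ← Real.sqrt_inv, ← Real.sqrt_mul (by positivity)]
    congr 1
    have := Real.pi_pos.ne'
    field_simp
    norm_num

/-- Gaussian linearization: exp(z²/4) is the mean of exp(z g / √2) for a standard normal g.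
Exchanging the means and using the subgaussian bound leaves E exp(g²/4) = √2. -/
theorem rademacher_exp_sq_le {ι : Type*} [Fintype ι] [DecidableEq ι] (c : ι → ℝ)
    (hc : ∑ i, c i ^ 2 ≤ 1) :
    ∑ y : ι → Bool, (∏ _i : ι, (1 / 2 : ℝ)) *
      Real.exp ((∑ i, (if y i then 1 else -1) * c i) ^ 2 / 4) ≤ Real.sqrt 2 := by
  have h2 : Real.sqrt 2 ^ 2 = 2 := Real.sq_sqrt (by norm_num)
  have hint : ∀ z : ℝ, Integrable (fun x => Real.exp (z * x)) (gaussianReal 0 1) :=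
    fun z => integrable_exp_mul_gaussianReal z
  have hz : ∀ z : ℝ, Real.exp (z ^ 2 / 4) =
      ∫ x, Real.exp (z / Real.sqrt 2 * x) ∂(gaussianReal 0 1) := by
    intro z
    rw [integral_exp_mul_gaussian, div_pow, h2]
    congr 1; ring
  simp_rw [hz, ← integral_const_mul]
  rw [← integral_finsetSum _ fun y _ => (hint _).const_mul _]
  refine le_trans (integral_mono (integrable_finsetSum _ fun y _ => (hint _).const_mul _)
    gaussian_exp_quarter_sq.1 fun x => ?_) gaussian_exp_quarter_sq.2.le
  have := rademacher_mgf_le c hc (x / Real.sqrt 2)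
  rw [div_pow, h2, div_div] at this
  norm_num at this ⊢
  refine le_trans (le_of_eq ?_) this
  refine Finset.sum_congr rfl fun y _ => ?_
  congr 2
  ring

/-! ### Curvature of the Bernoulli divergence in the log-odds. -/

/-- The log-odds function. -/
noncomputable def logit (x : ℝ) : ℝ := Real.log x - Real.log (1 - x)

theorem hasDerivAt_logit {x : ℝ} (h0 : 0 < x) (h1 : x < 1) :
    HasDerivAt logit (1 / (x * (1 - x))) x := by
  have hx : (1 - x) ≠ 0 := by linarith
  have h := (Real.hasDerivAt_log h0.ne').sub (((hasDerivAt_id x).const_sub 1).log hx)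
  refine h.congr_deriv ?_
  simp only [id]
  field_simp
  ring

theorem logit_one_sub (x : ℝ) : logit (1 - x) = -logit x := by
  unfold logit
  rw [sub_sub_cancel]
  ring

/-- The Kullback-Leibler divergence between Bernoulli laws. -/
noncomputable def bernoulliKL (p q : ℝ) : ℝ :=
  p * (Real.log p - Real.log q) + (1 - p) * (Real.log (1 - p) - Real.log (1 - q))

/-- Strong convexity of the Bernoulli log-partition function in the natural parameter. -/
theorem logit_sub_sq_le_bernoulliKL {p q m : ℝ} (hp0 : 0 < p) (hp1 : p < 1) (hq0 : 0 < q)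
    (hq1 : q < 1) (hmp : m ≤ p * (1 - p)) (hmq : m ≤ q * (1 - q)) :
    m / 2 * (logit q - logit p) ^ 2 ≤ bernoulliKL p q := by
  wlog hpq : p ≤ q generalizing p q
  · have := this (p := 1 - p) (q := 1 - q) (by linarith) (by linarith) (by linarith)
      (by linarith) (by linarith) (by linarith) (by linarith)
    rw [logit_one_sub, logit_one_sub] at this
    unfold bernoulliKL at this ⊢
    rw [sub_sub_cancel, sub_sub_cancel] at this
    linarith
  have hsub : ∀ x ∈ Set.Icc p q, 0 < x ∧ x < 1 := fun x hx => ⟨hp0.trans_le hx.1, hx.2.trans_lt hq1⟩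
  -- x(1 - x) is concave, so its minimum on the interval is at an endpoint.
  have hm : ∀ x ∈ Set.Icc p q, m ≤ x * (1 - x) := by
    rintro x ⟨h1, h2⟩
    rcases le_total (x + p) 1 with h | h <;> nlinarith
  have hderivψ : ∀ x ∈ Set.Icc p q,
      HasDerivAt (fun x => x - m * logit x) (1 - m * (1 / (x * (1 - x)))) x := fun x hx =>
    (hasDerivAt_id x).sub ((hasDerivAt_logit (hsub x hx).1 (hsub x hx).2).const_mul m)
  have hψ : MonotoneOn (fun x => x - m * logit x) (Set.Icc p q) := by
    refine monotoneOn_of_deriv_nonneg (convex_Icc p q)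
      (fun x hx => (hderivψ x hx).continuousAt.continuousWithinAt)
      (fun x hx => (hderivψ x (interior_subset hx)).differentiableAt.differentiableWithinAt) ?_
    intro x hx
    have hx := interior_subset hx
    rw [(hderivψ x hx).deriv, sub_nonneg, mul_one_div]
    have := hsub x hx
    exact div_le_one_of_le₀ (hm x hx) (mul_nonneg this.1.le (by linarith))
  -- The difference of the two sides vanishes at `x = p`; its derivative has the sign of the
  -- increment of `x - m * logit x` from `p`, which `hψ` makes nonnegative.
  have hderivD : ∀ x ∈ Set.Icc p q,
      HasDerivAt (fun x => bernoulliKL p x - m / 2 * (logit x - logit p) ^ 2)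
        ((x - p - m * (logit x - logit p)) / (x * (1 - x))) x := by
    intro x hx
    obtain ⟨h0, h1⟩ := hsub x hx
    have hx1 : (1 - x) ≠ 0 := by linarith
    have ha := ((Real.hasDerivAt_log h0.ne').const_sub (Real.log p)).const_mul p
    have hb := ((((hasDerivAt_id x).const_sub 1).log hx1).const_sub
      (Real.log (1 - p))).const_mul (1 - p)
    have hc := (((hasDerivAt_logit h0 h1).sub_const (logit p)).pow 2).const_mul (m / 2)
    refine ((ha.add hb).sub hc).congr_deriv ?_
    simp only [id, Nat.cast_ofNat, Nat.add_one_sub_one, pow_one]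
    field_simp
    ring
  have hD : MonotoneOn (fun x => bernoulliKL p x - m / 2 * (logit x - logit p) ^ 2)
      (Set.Icc p q) := by
    refine monotoneOn_of_deriv_nonneg (convex_Icc p q)
      (fun x hx => (hderivD x hx).continuousAt.continuousWithinAt)
      (fun x hx => (hderivD x (interior_subset hx)).differentiableAt.differentiableWithinAt) ?_
    intro x hx
    have hx := interior_subset hx
    rw [(hderivD x hx).deriv]
    have := hsub x hx
    have h2 := hψ ⟨le_rfl, hpq⟩ hx hx.1
    simp only at h2
    exact div_nonneg (by linarith) (mul_nonneg this.1.le (by linarith))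
  have := hD ⟨le_rfl, hpq⟩ ⟨hpq, le_rfl⟩ hpq
  simp only [bernoulliKL, sub_self] at this ⊢
  linarith

/-! ### Regularity of the three links. -/

/-- Quantitative regularity of a link function `f` on `[-α, α]`: its Bernoulli variance is at least
`m`, and its log-odds are bi-Lipschitz with constants `l` and `L`. -/
structure LinkRegular (f : ℝ → ℝ) (α m l L : ℝ) : Prop where
  pos : ∀ θ, |θ| ≤ α → 0 < f θ
  lt_one : ∀ θ, |θ| ≤ α → f θ < 1
  variance : ∀ θ, |θ| ≤ α → m ≤ f θ * (1 - f θ)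
  upper : ∀ θ θ', |θ| ≤ α → |θ'| ≤ α → |logit (f θ) - logit (f θ')| ≤ L * |θ - θ'|
  lower : ∀ θ θ', |θ| ≤ α → |θ'| ≤ α → l * |θ - θ'| ≤ |logit (f θ) - logit (f θ')|

theorem LinkRegular.scale {F : ℝ → ℝ} {x m l L α σ : ℝ} (h : LinkRegular F x m l L) (hσ : 0 < σ)
    (hx : α / σ = x) : LinkRegular (fun θ => F (θ / σ)) α m (l / σ) (L / σ) := by
  have habs : ∀ θ : ℝ, |θ| ≤ α → |θ / σ| ≤ x := fun θ hθ => by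
    rw [abs_div, abs_of_pos hσ, ← hx]
    gcongr
  have hdiff : ∀ (c θ θ' : ℝ), c / σ * |θ - θ'| = c * |θ / σ - θ' / σ| := fun c θ θ' => by
    rw [← sub_div, abs_div, abs_of_pos hσ]; ring
  exact ⟨fun θ hθ => h.pos _ (habs θ hθ), fun θ hθ => h.lt_one _ (habs θ hθ),
    fun θ hθ => h.variance _ (habs θ hθ),
    fun θ θ' hθ hθ' => by rw [hdiff]; exact h.upper _ _ (habs θ hθ) (habs θ' hθ'),
    fun θ θ' hθ hθ' => by rw [hdiff]; exact h.lower _ _ (habs θ hθ) (habs θ' hθ')⟩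

theorem logistic_pos_lt_one (t : ℝ) :
    0 < (1 + Real.exp (-t))⁻¹ ∧ (1 + Real.exp (-t))⁻¹ < 1 := by
  have := Real.exp_pos (-t)
  exact ⟨by positivity, inv_lt_one_of_one_lt₀ (by linarith)⟩

/-- The log-odds of the logistic link are the identity, so only the variance 1/(2 + e^t + e^(-t))
needs a bound, from the monotonicity of cosh in |t|. -/
theorem logistic_regular (x : ℝ) :
    LinkRegular (fun t => (1 + Real.exp (-t))⁻¹) x (1 / (2 + Real.exp x + Real.exp (-x))) 1 1 := by
  have h1 : ∀ t : ℝ, 1 - (1 + Real.exp (-t))⁻¹ = Real.exp (-t) * (1 + Real.exp (-t))⁻¹ := by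
    intro t
    have : 1 + Real.exp (-t) ≠ 0 := by positivity
    field_simp
    ring
  have hlogit : ∀ t : ℝ, logit ((1 + Real.exp (-t))⁻¹) = t := by
    intro t
    unfold logit
    rw [h1, Real.log_mul (Real.exp_pos _).ne' (by positivity), Real.log_exp]
    ring
  refine ⟨fun t _ => (logistic_pos_lt_one t).1, fun t _ => (logistic_pos_lt_one t).2, ?_, ?_, ?_⟩
  · intro t ht
    have h2 : (1 + Real.exp (-t))⁻¹ * (1 - (1 + Real.exp (-t))⁻¹) =
        1 / (2 + Real.exp t + Real.exp (-t)) := by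
      rw [h1]
      have hmul : Real.exp t * Real.exp (-t) = 1 := by rw [← Real.exp_add]; simp
      have h3 : 1 + Real.exp (-t) ≠ 0 := by positivity
      have h4 : 2 + Real.exp t + Real.exp (-t) ≠ 0 := by positivity
      field_simp
      linear_combination hmul
    rw [h2]
    have hc : Real.cosh t ≤ Real.cosh x := Real.cosh_le_cosh.2 (ht.trans (le_abs_self x))
    rw [Real.cosh_eq, Real.cosh_eq] at hc
    exact one_div_le_one_div_of_le (by positivity) (by linarith)
  · intro t t' _ _
    rw [hlogit, hlogit, one_mul]
  · intro t t' _ _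
    rw [hlogit, hlogit, one_mul]

/-- A function whose increments lie between `l` and `L` times those of the identity. -/
theorem biLipschitz_of_monotone {h : ℝ → ℝ} {l L : ℝ} (hl : 0 ≤ l) {s : Set ℝ}
    (h1 : MonotoneOn (fun t => h t - l * t) s)
    (h2 : MonotoneOn (fun t => L * t - h t) s) {t t' : ℝ} (ht : t ∈ s) (ht' : t' ∈ s) :
    |h t - h t'| ≤ L * |t - t'| ∧ l * |t - t'| ≤ |h t - h t'| := by
  wlog htt : t' ≤ t generalizing t t'
  · rw [abs_sub_comm (h t), abs_sub_comm t]
    exact this ht' ht (le_of_not_ge htt)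
  have e1 := h1 ht' ht htt
  have e2 := h2 ht' ht htt
  simp only at e1 e2
  have e3 : 0 ≤ l * (t - t') := mul_nonneg hl (sub_nonneg.2 htt)
  rw [abs_of_nonneg (sub_nonneg.2 htt), abs_of_nonneg (by linarith)]
  constructor <;> linarith

/-- The standard Laplacian distribution function. -/
noncomputable def laplaceFn (t : ℝ) : ℝ :=
  if t < 0 then (1 / 2) * Real.exp t else 1 - (1 / 2) * Real.exp (-t)

theorem logit_laplaceFn_of_nonpos {t : ℝ} (ht : t ≤ 0) :
    logit (laplaceFn t) = t - Real.log (2 - Real.exp t) := by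
  have h1 : laplaceFn t = (1 / 2) * Real.exp t := by
    unfold laplaceFn
    split_ifs with h
    · rfl
    · rw [le_antisymm ht (not_lt.1 h)]; norm_num
  have h2 : Real.exp t ≤ 1 := Real.exp_le_one_iff.2 ht
  rw [h1, logit, Real.log_mul (by norm_num) (Real.exp_pos t).ne', Real.log_exp,
    show 1 - 1 / 2 * Real.exp t = 1 / 2 * (2 - Real.exp t) by ring,
    Real.log_mul (by norm_num) (by linarith)]
  ring

theorem logit_laplaceFn_of_nonneg {t : ℝ} (ht : 0 ≤ t) :
    logit (laplaceFn t) = t + Real.log (2 - Real.exp (-t)) := by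
  have h1 : laplaceFn t = 1 - (1 / 2) * Real.exp (-t) := by
    unfold laplaceFn
    rw [if_neg (not_lt.2 ht)]
  have h2 : Real.exp (-t) ≤ 1 := Real.exp_le_one_iff.2 (by linarith)
  rw [h1, logit, sub_sub_cancel, Real.log_mul (by norm_num) (Real.exp_pos _).ne', Real.log_exp,
    show 1 - 1 / 2 * Real.exp (-t) = 1 / 2 * (2 - Real.exp (-t)) by ring,
    Real.log_mul (by norm_num) (by linarith)]
  ring

/-- For t ≥ 0 the slope of log(2 - e^(-t)) is e^(-t)/(2 - e^(-t)), between 0 and 1. Added to the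
slope 1 of the linear part, it gives Laplacian log-odds with slope between 1 and 2. -/
theorem log_two_sub_exp_neg {t s : ℝ} (ht : 0 ≤ t) (hts : t ≤ s) :
    Real.log (2 - Real.exp (-t)) ≤ Real.log (2 - Real.exp (-s)) ∧
      Real.log (2 - Real.exp (-s)) ≤ Real.log (2 - Real.exp (-t)) + (s - t) := by
  have h1 : Real.exp (-t) ≤ 1 := Real.exp_le_one_iff.2 (by linarith)
  have h2 : Real.exp (-s) ≤ Real.exp (-t) := Real.exp_le_exp.2 (by linarith)
  refine ⟨Real.log_le_log (by linarith) (by linarith), ?_⟩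
  suffices Real.log (2 - Real.exp (-s)) ≤
      Real.log (2 - Real.exp (-t)) + Real.log (Real.exp (s - t)) by rwa [Real.log_exp] at this
  rw [← Real.log_mul (by linarith) (Real.exp_pos _).ne']
  refine Real.log_le_log (by linarith) ?_
  have h3 : Real.exp (-t) = Real.exp (-s) * Real.exp (s - t) := by
    rw [← Real.exp_add]; congr 1; ring
  have h4 : 1 ≤ Real.exp (s - t) := Real.one_le_exp (by linarith)
  have h5 := Real.exp_pos (-s)
  have h6 : Real.exp (-s) * Real.exp (s - t) ≤ 1 := h3 ▸ h1
  nlinarith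

theorem laplace_regular (x : ℝ) :
    LinkRegular laplaceFn x (1 / 4 * Real.exp (-x)) 1 2 := by
  have hm1 : Monotone fun t => logit (laplaceFn t) - 1 * t := by
    refine MonotoneOn.Iic_union_Ici (a := 0) ?_ ?_
    · intro s hs t ht hst
      simp only [logit_laplaceFn_of_nonpos hs, logit_laplaceFn_of_nonpos ht]
      have := (log_two_sub_exp_neg (neg_nonneg.2 ht) (neg_le_neg hst)).1
      rw [neg_neg, neg_neg] at this
      linarith
    · intro s hs t ht hst
      simp only [logit_laplaceFn_of_nonneg hs, logit_laplaceFn_of_nonneg ht]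
      linarith [(log_two_sub_exp_neg hs hst).1]
  have hm2 : Monotone fun t => 2 * t - logit (laplaceFn t) := by
    refine MonotoneOn.Iic_union_Ici (a := 0) ?_ ?_
    · intro s hs t ht hst
      simp only [logit_laplaceFn_of_nonpos hs, logit_laplaceFn_of_nonpos ht]
      have := (log_two_sub_exp_neg (neg_nonneg.2 ht) (neg_le_neg hst)).2
      rw [neg_neg, neg_neg] at this
      linarith
    · intro s hs t ht hst
      simp only [logit_laplaceFn_of_nonneg hs, logit_laplaceFn_of_nonneg ht]
      linarith [(log_two_sub_exp_neg hs hst).2]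
  have hval : ∀ t, 0 < laplaceFn t ∧ laplaceFn t < 1 ∧
      1 / 4 * Real.exp (-|t|) ≤ laplaceFn t * (1 - laplaceFn t) := by
    intro t
    unfold laplaceFn
    have h0 := Real.exp_pos (-|t|)
    have h1 : Real.exp (-|t|) ≤ 1 := Real.exp_le_one_iff.2 (by linarith [abs_nonneg t])
    split_ifs with h
    · rw [abs_of_neg h, neg_neg] at *
      refine ⟨by positivity, by linarith, by nlinarith⟩
    · rw [abs_of_nonneg (not_lt.1 h)] at *
      refine ⟨by linarith, by linarith, by nlinarith⟩
  refine ⟨fun t _ => (hval t).1, fun t _ => (hval t).2.1, ?_, ?_, ?_⟩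
  · intro t ht
    refine le_trans ?_ (hval t).2.2
    gcongr
  · intro t t' _ _
    exact (biLipschitz_of_monotone zero_le_one (hm1.monotoneOn Set.univ) (hm2.monotoneOn Set.univ)
      (Set.mem_univ t) (Set.mem_univ t')).1
  · intro t t' _ _
    exact (biLipschitz_of_monotone zero_le_one (hm1.monotoneOn Set.univ) (hm2.monotoneOn Set.univ)
      (Set.mem_univ t) (Set.mem_univ t')).2

/-- The standard Gaussian distribution function. -/
noncomputable def probitFn (x : ℝ) : ℝ := cdf (gaussianReal 0 1) x

theorem gaussianPDFReal_std (x : ℝ) :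
    gaussianPDFReal 0 1 x = (Real.sqrt (2 * Real.pi))⁻¹ * Real.exp (-x ^ 2 / 2) := by
  simp [gaussianPDFReal]

theorem probitFn_eq_integral (x : ℝ) :
    probitFn x = ∫ t in Set.Iic x, gaussianPDFReal 0 1 t := by
  rw [probitFn, cdf_eq_real, measureReal_def, gaussianReal_apply_eq_integral _ one_ne_zero,
    ENNReal.toReal_ofReal]
  exact integral_nonneg fun t => gaussianPDFReal_nonneg _ _ _

theorem continuous_gaussianPDFReal_std : Continuous (gaussianPDFReal 0 1) := by
  rw [funext gaussianPDFReal_std]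
  fun_prop

theorem hasDerivAt_probitFn (x : ℝ) : HasDerivAt probitFn (gaussianPDFReal 0 1 x) x := by
  have h : probitFn = fun x => probitFn 0 + ∫ t in (0 : ℝ)..x, gaussianPDFReal 0 1 t := by
    funext y
    have hi := integrable_gaussianPDFReal 0 1
    rw [← intervalIntegral.integral_Iic_sub_Iic hi.integrableOn hi.integrableOn,
      ← probitFn_eq_integral, ← probitFn_eq_integral]
    ring
  rw [h]
  exact ((continuous_gaussianPDFReal_std.integral_hasStrictDerivAt 0 x).hasDerivAt).const_add _

theorem one_sub_probitFn (x : ℝ) : 1 - probitFn x = (gaussianReal 0 1).real (Set.Ici x) := by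
  rw [probitFn, cdf_eq_real, ← probReal_compl_eq_one_sub measurableSet_Iic, Set.compl_Iic]
  have := nullSingletonClass_gaussianReal (μ := 0) (v := 1) one_ne_zero
  exact measureReal_congr Ioi_ae_eq_Ici

theorem probitFn_neg (x : ℝ) : probitFn (-x) = 1 - probitFn x := by
  rw [one_sub_probitFn, probitFn, cdf_eq_real]
  have h : (gaussianReal 0 1).map (fun x : ℝ => -x) = gaussianReal 0 1 := by
    rw [gaussianReal_map_neg, neg_zero]
  nth_rewrite 1 [← h]
  rw [map_measureReal_apply measurable_neg measurableSet_Iic]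
  congr 1
  ext y
  simp

/-- Chernoff bound with parameter equal to the threshold. -/
theorem one_sub_probitFn_le {x : ℝ} (hx : 0 ≤ x) :
    1 - probitFn x ≤ Real.sqrt (2 * Real.pi) * gaussianPDFReal 0 1 x := by
  have h := measure_ge_le_exp_mul_mgf (X := id) (μ := gaussianReal 0 1) x hx
    (integrable_exp_mul_gaussianReal x)
  rw [mgf_id_gaussianReal] at h
  rw [one_sub_probitFn, gaussianPDFReal_std, mul_inv_cancel_left₀ (by positivity)]
  refine h.trans (le_of_eq ?_)
  rw [← Real.exp_add]
  congr 1
  simp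
  ring

theorem gaussianPDFReal_std_antitone {x y : ℝ} (hx : 0 ≤ x) (hxy : x ≤ y) :
    gaussianPDFReal 0 1 y ≤ gaussianPDFReal 0 1 x := by
  rw [gaussianPDFReal_std, gaussianPDFReal_std]
  gcongr

/-- The tail contains the mass of [x, x + δ] with δ = 1/(1 + x). As (x + δ)² - x² = 2xδ + δ² ≤ 3,
the density there is at least e^(-3/2) times its value at x. -/
theorem le_one_sub_probitFn {x : ℝ} (hx : 0 ≤ x) :
    Real.exp (-(3 / 2)) / (1 + x) * gaussianPDFReal 0 1 x ≤ 1 - probitFn x := by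
  have hx1 : 0 < 1 + x := by linarith
  set δ := 1 / (1 + x) with hδ
  have hδ0 : 0 < δ := by positivity
  have hδ1 : δ * (1 + x) = 1 := by rw [hδ]; field_simp
  have h1 : gaussianPDFReal 0 1 (x + δ) * (x + δ - x) ≤ probitFn (x + δ) - probitFn x := by
    refine (convex_Icc x (x + δ)).mul_sub_le_image_sub_of_le_deriv
      (fun y _ => (hasDerivAt_probitFn y).continuousAt.continuousWithinAt)
      (fun y _ => (hasDerivAt_probitFn y).differentiableAt.differentiableWithinAt)
      (fun y hy => ?_) x ⟨le_rfl, by linarith⟩ (x + δ) ⟨by linarith, le_rfl⟩ (by linarith)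
    have hy := interior_subset hy
    rw [(hasDerivAt_probitFn y).deriv]
    exact gaussianPDFReal_std_antitone (hx.trans hy.1) hy.2
  have h2 : probitFn (x + δ) ≤ 1 := cdf_le_one _ _
  have h3 : Real.exp (-(3 / 2)) * gaussianPDFReal 0 1 x ≤ gaussianPDFReal 0 1 (x + δ) := by
    rw [gaussianPDFReal_std, gaussianPDFReal_std, mul_left_comm, ← Real.exp_add]
    gcongr
    have hδle : δ ≤ 1 := by nlinarith
    nlinarith
  calc _ = δ * (Real.exp (-(3 / 2)) * gaussianPDFReal 0 1 x) := by rw [hδ]; ring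
    _ ≤ δ * gaussianPDFReal 0 1 (x + δ) := by gcongr
    _ ≤ _ := by linarith

theorem half_le_probitFn {x : ℝ} (hx : 0 ≤ x) : 1 / 2 ≤ probitFn x := by
  have h0 := probitFn_neg 0
  rw [neg_zero] at h0
  have : probitFn 0 ≤ probitFn x := monotone_cdf _ hx
  linarith

theorem gaussianPDFReal_std_abs (x : ℝ) : gaussianPDFReal 0 1 |x| = gaussianPDFReal 0 1 x := by
  rw [gaussianPDFReal_std, gaussianPDFReal_std, sq_abs]

theorem probitFn_variance_abs (x : ℝ) :
    probitFn |x| * (1 - probitFn |x|) = probitFn x * (1 - probitFn x) := by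
  rcases abs_cases x with h | h
  · rw [h.1]
  · rw [h.1, probitFn_neg]; ring

theorem probitFn_variance_bounds (x : ℝ) :
    Real.exp (-(3 / 2)) / (2 * (1 + |x|)) * gaussianPDFReal 0 1 x ≤ probitFn x * (1 - probitFn x) ∧
      probitFn x * (1 - probitFn x) ≤ Real.sqrt (2 * Real.pi) * gaussianPDFReal 0 1 x := by
  rw [← probitFn_variance_abs, ← gaussianPDFReal_std_abs x]
  have h0 := abs_nonneg x
  have h1 := half_le_probitFn h0
  have h2 := le_one_sub_probitFn h0
  have h3 := one_sub_probitFn_le h0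
  have h4 : probitFn |x| ≤ 1 := cdf_le_one _ _
  constructor
  · calc _ = 1 / 2 * (Real.exp (-(3 / 2)) / (1 + |x|) * gaussianPDFReal 0 1 |x|) := by
          field_simp
      _ ≤ 1 / 2 * (1 - probitFn |x|) := by gcongr
      _ ≤ _ := mul_le_mul_of_nonneg_right h1 (by linarith)
  · exact (mul_le_of_le_one_left (by linarith) h4).trans h3

theorem probitFn_pos_lt_one (x : ℝ) : 0 < probitFn x ∧ probitFn x < 1 := by
  have h1 := (probitFn_variance_bounds x).1
  have h2 : 0 < Real.exp (-(3 / 2)) / (2 * (1 + |x|)) * gaussianPDFReal 0 1 x :=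
    mul_pos (by positivity) (gaussianPDFReal_pos _ _ _ one_ne_zero)
  have h3 : 0 ≤ probitFn x := cdf_nonneg _ _
  have h4 : probitFn x ≤ 1 := cdf_le_one _ _
  constructor <;> by_contra! h <;> nlinarith

/-- The log-odds have derivative φ/(Φ(1 - Φ)), and `probitFn_variance_bounds` compares its
denominator with φ from both sides. -/
theorem probit_regular {x : ℝ} (_ : 0 ≤ x) :
    LinkRegular probitFn x (Real.exp (-(3 / 2)) / (2 * (1 + x)) * gaussianPDFReal 0 1 x)
      (Real.sqrt (2 * Real.pi))⁻¹ (2 * (1 + x) * Real.exp (3 / 2)) := by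
  have hvar : ∀ t, 0 < probitFn t * (1 - probitFn t) := fun t =>
    mul_pos (probitFn_pos_lt_one t).1 (sub_pos.2 (probitFn_pos_lt_one t).2)
  have hder : ∀ t, HasDerivAt (fun t => logit (probitFn t))
      (gaussianPDFReal 0 1 t / (probitFn t * (1 - probitFn t))) t := fun t => by
    have := (hasDerivAt_logit (probitFn_pos_lt_one t).1 (probitFn_pos_lt_one t).2).comp t
      (hasDerivAt_probitFn t)
    refine this.congr_deriv ?_
    ring
  have hlow : ∀ t, (Real.sqrt (2 * Real.pi))⁻¹ ≤
      gaussianPDFReal 0 1 t / (probitFn t * (1 - probitFn t)) := by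
    intro t
    rw [le_div_iff₀ (hvar t), inv_mul_le_iff₀ (by positivity)]
    exact (probitFn_variance_bounds t).2
  have hupp : ∀ t ∈ Set.Icc (-x) x, gaussianPDFReal 0 1 t / (probitFn t * (1 - probitFn t)) ≤
      2 * (1 + x) * Real.exp (3 / 2) := by
    intro t ht
    have htx : |t| ≤ x := abs_le.2 ht
    have h0 := gaussianPDFReal_nonneg 0 1 t
    rw [div_le_iff₀ (hvar t)]
    have h1 : 2 * (1 + |t|) * Real.exp (3 / 2) *
        (Real.exp (-(3 / 2)) / (2 * (1 + |t|)) * gaussianPDFReal 0 1 t) =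
          gaussianPDFReal 0 1 t := by
      have : Real.exp (3 / 2) * Real.exp (-(3 / 2)) = 1 := by rw [← Real.exp_add]; simp
      have h2 : 1 + |t| ≠ 0 := by positivity
      field_simp
      linear_combination (gaussianPDFReal 0 1 t) * this
    calc _ ≤ 2 * (1 + |t|) * Real.exp (3 / 2) * (probitFn t * (1 - probitFn t)) := by
          nth_rewrite 1 [← h1]
          exact mul_le_mul_of_nonneg_left (probitFn_variance_bounds t).1 (by positivity)
      _ ≤ _ := by
          have := hvar t
          gcongr
  have hm1 : MonotoneOn (fun t => logit (probitFn t) - (Real.sqrt (2 * Real.pi))⁻¹ * t)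
      (Set.Icc (-x) x) := by
    have hd : ∀ t, HasDerivAt (fun t => logit (probitFn t) - (Real.sqrt (2 * Real.pi))⁻¹ * t)
        (gaussianPDFReal 0 1 t / (probitFn t * (1 - probitFn t)) -
          (Real.sqrt (2 * Real.pi))⁻¹ * 1) t := fun t =>
      (hder t).sub ((hasDerivAt_id t).const_mul _)
    refine monotoneOn_of_deriv_nonneg (convex_Icc _ _)
      (fun t _ => (hd t).continuousAt.continuousWithinAt)
      (fun t _ => (hd t).differentiableAt.differentiableWithinAt) fun t _ => ?_
    rw [(hd t).deriv]
    linarith [hlow t]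
  have hm2 : MonotoneOn (fun t => 2 * (1 + x) * Real.exp (3 / 2) * t - logit (probitFn t))
      (Set.Icc (-x) x) := by
    have hd : ∀ t, HasDerivAt (fun t => 2 * (1 + x) * Real.exp (3 / 2) * t - logit (probitFn t))
        (2 * (1 + x) * Real.exp (3 / 2) * 1 -
          gaussianPDFReal 0 1 t / (probitFn t * (1 - probitFn t))) t := fun t =>
      ((hasDerivAt_id t).const_mul _).sub (hder t)
    refine monotoneOn_of_deriv_nonneg (convex_Icc _ _)
      (fun t _ => (hd t).continuousAt.continuousWithinAt)
      (fun t _ => (hd t).differentiableAt.differentiableWithinAt) fun t ht => ?_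
    rw [(hd t).deriv]
    linarith [hupp t (interior_subset ht)]
  refine ⟨fun t _ => (probitFn_pos_lt_one t).1, fun t _ => (probitFn_pos_lt_one t).2, ?_, ?_, ?_⟩
  · intro t ht
    refine le_trans ?_ (probitFn_variance_bounds t).1
    have h1 : gaussianPDFReal 0 1 x ≤ gaussianPDFReal 0 1 t := by
      rw [← gaussianPDFReal_std_abs t]
      exact gaussianPDFReal_std_antitone (abs_nonneg t) ht
    have h2 := gaussianPDFReal_nonneg 0 1 x
    gcongr
  · exact fun t t' ht ht' =>
      (biLipschitz_of_monotone (by positivity) hm1 hm2 (abs_le.1 ht) (abs_le.1 ht')).1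
  · exact fun t t' ht ht' =>
      (biLipschitz_of_monotone (by positivity) hm1 hm2 (abs_le.1 ht) (abs_le.1 ht')).2

theorem one_add_sq_le_exp (x : ℝ) : (1 + x) ^ 2 ≤ 4 * Real.exp (x ^ 2 / 2) := by
  have := Real.add_one_le_exp (x ^ 2 / 2)
  nlinarith [sq_nonneg (x - 1)]

theorem scaleFactor_mul (c : ℝ) (C₁ C₂ C₃ : ℝ) (link : Link) (α σ : ℝ) :
    link.scaleFactor (c * C₁) (c * C₂) (c * C₃) α σ = c * link.scaleFactor C₁ C₂ C₃ α σ := by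
  cases link <;> simp only [Link.scaleFactor] <;> ring

/-- Each link is regular, with constants matching its scale factor. -/
theorem exists_linkRegular : ∃ κ : ℝ, 0 < κ ∧ ∀ (link : Link) (α σ : ℝ), 0 < α → 0 < σ →
    ∃ m l L : ℝ, 0 < m ∧ 0 < l ∧ 0 < L ∧ LinkRegular (link.fn σ) α m l L ∧
      L / (m * l ^ 2) ≤ κ * link.scaleFactor 1 1 1 α σ := by
  set B := 2 * Real.pi * Real.sqrt (2 * Real.pi) * Real.exp (3 / 2) * Real.exp (3 / 2) with hB
  have hB0 : 0 < B := by positivity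
  -- The logistic link needs the constant 1, the Laplacian 8 and the probit 96 B.
  refine ⟨8 + 96 * B, by positivity, ?_⟩
  intro link α σ hα hσ
  have hx : 0 < α / σ := by positivity
  cases link with
  | logistic =>
    refine ⟨1 / (2 + Real.exp (α / σ) + Real.exp (-(α / σ))), 1 / σ, 1 / σ, ?_, by positivity, by positivity, ?_, ?_⟩
    rotate_left
    · convert (logistic_regular (α / σ)).scale hσ rfl using 1
      funext θ
      simp only [Link.fn, neg_div]
    · simp only [Link.scaleFactor, neg_div]
      have : 1 / σ / (1 / (2 + Real.exp (α / σ) + Real.exp (-(α / σ))) * (1 / σ) ^ 2) =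
          1 * (1 * σ * (2 + Real.exp (α / σ) + Real.exp (-(α / σ)))) := by
        field_simp
      rw [this]
      exact mul_le_mul_of_nonneg_right (by linarith) (by positivity)
    · positivity
  | laplacian =>
    refine ⟨1 / 4 * Real.exp (-(α / σ)), 1 / σ, 2 / σ, ?_, by positivity, by positivity, ?_, ?_⟩
    rotate_left
    · convert (laplace_regular (α / σ)).scale hσ rfl using 1
      funext θ
      have : θ / σ < 0 ↔ θ < 0 := by rw [div_lt_iff₀ hσ, zero_mul]
      simp only [Link.fn, laplaceFn, this, neg_div]
    · simp only [Link.scaleFactor]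
      have : 2 / σ / (1 / 4 * Real.exp (-(α / σ)) * (1 / σ) ^ 2) =
          8 * (1 * σ * Real.exp (α / σ)) := by
        rw [Real.exp_neg]
        field_simp
        ring
      rw [this]
      exact mul_le_mul_of_nonneg_right (by linarith) (by positivity)
    · positivity
  | probit =>
    refine ⟨_, (Real.sqrt (2 * Real.pi))⁻¹ / σ, 2 * (1 + α / σ) * Real.exp (3 / 2) / σ, ?_,
      by positivity, by positivity, (probit_regular hx.le).scale hσ rfl, ?_⟩
    · exact mul_pos (by positivity) (gaussianPDFReal_pos _ _ _ one_ne_zero)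
    · rw [gaussianPDFReal_std]
      simp only [Link.scaleFactor, ← div_pow]
      set x := α / σ with hxdef
      have hratio : 1 / 6 ≤ (α + σ) / (6 * α + σ) := by
        rw [le_div_iff₀ (by positivity)]; linarith
      have h2 : Real.sqrt (2 * Real.pi) ^ 2 = 2 * Real.pi := Real.sq_sqrt (by positivity)
      have h1 : 2 * (1 + x) * Real.exp (3 / 2) / σ /
          (Real.exp (-(3 / 2)) / (2 * (1 + x)) *
            ((Real.sqrt (2 * Real.pi))⁻¹ * Real.exp (-x ^ 2 / 2)) *
              ((Real.sqrt (2 * Real.pi))⁻¹ / σ) ^ 2) =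
          4 * B * σ * (1 + x) ^ 2 * Real.exp (x ^ 2 / 2) := by
        have h0 : Real.sqrt (2 * Real.pi) ≠ 0 := by positivity
        rw [hB, neg_div, Real.exp_neg, Real.exp_neg]
        generalize Real.sqrt (2 * Real.pi) = S at h0 h2
        rw [← h2]
        have : 1 + x ≠ 0 := by positivity
        field_simp
        ring
      rw [h1]
      have h3 : Real.exp (x ^ 2) = Real.exp (x ^ 2 / 2) * Real.exp (x ^ 2 / 2) := by
        rw [← Real.exp_add]; congr 1; ring
      -- The polynomial (1 + x)² is absorbed into a second factor e^(x²/2), giving e^(x²); the 6 in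
      -- 96 = 16 · 6 offsets the lower bound `hratio`.
      calc _ ≤ 4 * B * σ * (4 * Real.exp (x ^ 2 / 2)) * Real.exp (x ^ 2 / 2) := by
            gcongr
            exact one_add_sq_le_exp x
        _ = 96 * B * (1 * σ * (1 / 6) * Real.exp (x ^ 2)) := by rw [h3]; ring
        _ ≤ (8 + 96 * B) * (1 * σ * ((α + σ) / (6 * α + σ)) * Real.exp (x ^ 2)) := by
            gcongr
            linarith

/-! ### Law of the data and the basic inequality. -/

theorem FollowsBernoulliModel.measureReal_eq {K : ℕ} {d : Fin K → ℕ} {Ω : Type*}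
    [MeasurableSpace Ω] {μ : Measure Ω} [IsProbabilityMeasure μ] {f : ℝ → ℝ} {Θ : RealTensor d}
    {Y : Ω → BinTensor d} (h : FollowsBernoulliModel μ f Θ Y) (y : BinTensor d) :
    μ.real {ω | Y ω = y} = ∏ i, if y i then f (Θ i) else 1 - f (Θ i) := by
  have h1 := h.indep.measure_inter_preimage_eq_mul Finset.univ (sets := fun i => {y i})
    fun i _ => MeasurableSet.singleton _
  have h2 : {ω | Y ω = y} = ⋂ i ∈ Finset.univ, (fun ω => Y ω i) ⁻¹' {y i} := by
    ext ω
    simp [funext_iff]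
  rw [h2, measureReal_def, h1, ENNReal.toReal_prod]
  refine Finset.prod_congr rfl fun i _ => ?_
  rw [← measureReal_def]
  have h3 : (fun ω => Y ω i) ⁻¹' {true} = {ω | Y ω i = true} := rfl
  cases hy : y i with
  | true => simpa [h3] using h.prob_one i
  | false =>
    have h4 : (fun ω => Y ω i) ⁻¹' {false} = {ω | Y ω i = true}ᶜ := by
      ext ω
      simp
    have h5 : MeasurableSet {ω | Y ω i = true} := h.measurable i (MeasurableSet.singleton true)
    rw [h4, probReal_compl_eq_one_sub h5, h.prob_one i]
    simp

theorem FollowsBernoulliModel.measureReal_le_sum {K : ℕ} {d : Fin K → ℕ} {Ω : Type*}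
    [MeasurableSpace Ω] {μ : Measure Ω} [IsProbabilityMeasure μ] {f : ℝ → ℝ} {Θ : RealTensor d}
    {Y : Ω → BinTensor d} (h : FollowsBernoulliModel μ f Θ Y) (S : Finset (BinTensor d)) :
    μ.real {ω | Y ω ∈ S} ≤ ∑ y ∈ S, ∏ i, if y i then f (Θ i) else 1 - f (Θ i) := by
  have h1 : {ω | Y ω ∈ S} = ⋃ y ∈ S, {ω | Y ω = y} := by
    ext ω
    simp
  rw [h1]
  refine (measureReal_biUnion_finset_le _ _).trans (le_of_eq ?_)
  exact Finset.sum_congr rfl fun y _ => h.measureReal_eq y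

theorem logLikelihood_sub {K : ℕ} {d : Fin K → ℕ} (f : ℝ → ℝ) (y : BinTensor d)
    (Θ Θ' : RealTensor d) :
    logLikelihood f y Θ' - logLikelihood f y Θ =
      ∑ i, ((if y i then 1 else 0) - f (Θ i)) * (logit (f (Θ' i)) - logit (f (Θ i))) -
        ∑ i, bernoulliKL (f (Θ i)) (f (Θ' i)) := by
  rw [logLikelihood, logLikelihood, ← Finset.sum_sub_distrib, ← Finset.sum_sub_distrib]
  refine Finset.sum_congr rfl fun i _ => ?_
  unfold logit bernoulliKL
  split_ifs <;> ring

theorem LinkRegular.le_bernoulliKL {f : ℝ → ℝ} {α m l L : ℝ} (h : LinkRegular f α m l L)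
    (hm : 0 ≤ m) (hl : 0 ≤ l) {θ θ' : ℝ} (hθ : |θ| ≤ α) (hθ' : |θ'| ≤ α) :
    m * l ^ 2 / 2 * (θ' - θ) ^ 2 ≤ bernoulliKL (f θ) (f θ') := by
  refine le_trans ?_ (logit_sub_sq_le_bernoulliKL (h.pos θ hθ) (h.lt_one θ hθ) (h.pos θ' hθ')
    (h.lt_one θ' hθ') (h.variance θ hθ) (h.variance θ' hθ'))
  have h1 : (l * |θ' - θ|) ^ 2 ≤ (logit (f θ') - logit (f θ)) ^ 2 := by
    rw [← sq_abs (logit _ - _)]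
    exact pow_le_pow_left₀ (by positivity) (h.lower θ' θ hθ' hθ) 2
  rw [mul_pow, sq_abs] at h1
  nlinarith

/-- The curvature of the expected log-likelihood is paid for by the noise at the maximizer. -/
theorem IsConstrainedMLE.basic_inequality {K : ℕ} {d : Fin K → ℕ} {f : ℝ → ℝ} {α m l L : ℝ}
    (h : LinkRegular f α m l L) (hm : 0 ≤ m) (hl : 0 ≤ l) {D : Set (RealTensor d)}
    (hD : ∀ Θ ∈ D, ∀ i, |Θ i| ≤ α) {Θ Θ' : RealTensor d} (hΘ : Θ ∈ D) {y : BinTensor d}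
    (hmle : IsConstrainedMLE f D y Θ') :
    m * l ^ 2 / 2 * ∑ i, (Θ' i - Θ i) ^ 2 ≤
      ∑ i, ((if y i then 1 else 0) - f (Θ i)) * (logit (f (Θ' i)) - logit (f (Θ i))) := by
  have h1 := logLikelihood_sub f y Θ Θ'
  have h2 : logLikelihood f y Θ ≤ logLikelihood f y Θ' := hmle.2 hΘ
  have h3 : m * l ^ 2 / 2 * ∑ i, (Θ' i - Θ i) ^ 2 ≤ ∑ i, bernoulliKL (f (Θ i)) (f (Θ' i)) := by
    rw [Finset.mul_sum]
    exact Finset.sum_le_sum fun i _ =>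
      h.le_bernoulliKL hm hl (hD Θ hΘ i) (hD Θ' hmle.1 i)
  linarith

/-! ### Exponential moment and tail bound. -/

/-- Duality for the difference of two tensors of CP rank `R`. -/
theorem sum_mul_sub_le {K : ℕ} {d : Fin (K + 1) → ℕ} {R : ℕ} {Θ Θ' ε : RealTensor d}
    (h : HasCPDecomposition Θ R) (h' : HasCPDecomposition Θ' R) {s : ℝ}
    (hs : ∀ x, (∀ k, ‖x k‖ ≤ 1) → multiForm ε x ≤ s) :
    ∑ i, ε i * (Θ' i - Θ i) ≤
      s * Real.sqrt ((2 * R : ℝ) ^ K) * Real.sqrt (∑ i, (Θ' i - Θ i) ^ 2) := by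
  obtain ⟨w, a, -, -, -, hw⟩ := h
  obtain ⟨w', a', -, -, -, hw'⟩ := h'
  -- Both decompositions are concatenated, the second with negated weights: 2R terms.
  have := sum_mul_le_of_multiForm_le (ρ := Fin R ⊕ Fin R) (Sum.elim w' (-w)) (Sum.elim a' a)
    (Θ' - Θ) ε (fun i => by simp [hw, hw', sub_eq_add_neg]) hs
  have hc : ((Fintype.card (Fin R ⊕ Fin R) : ℕ) : ℝ) = 2 * R := by
    simp [two_mul]
  rw [hc] at this
  simpa only [Pi.sub_apply] using this

/-- Exponential moment of the penalized linear Rademacher process indexed by differences of tensors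
of CP rank `R`. -/
theorem rademacher_penalized_sup_le {K : ℕ} {d : Fin (K + 1) → ℕ} {R : ℕ} {τ : Type*} [Finite τ]
    [Nonempty τ] (hR : 1 ≤ R) (Θ : RealTensor d) (T : τ → RealTensor d)
    (hΘ : HasCPDecomposition Θ R) (hT : ∀ t, HasCPDecomposition (T t) R) {γ L lam : ℝ}
    (hγ : 0 < γ) (hL : 0 < L)
    (hlam : lam = γ / (2 * 4 ^ (K + 1) * L ^ 2 * (2 * R) ^ K)) :
    ∑ y : Idx d → Bool, (∏ _i : Idx d, (1 / 2 : ℝ)) *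
        Real.exp (⨆ t, (-(lam * (γ / 2) * ∑ i, (T t i - Θ i) ^ 2) +
          ∑ i, (if y i then 1 else -1) * (lam * L * (T t i - Θ i)))) ≤
      5 ^ (∑ k, d k) * Real.sqrt 2 := by
  have hRpos : (0 : ℝ) < (2 * R) ^ K := by
    have : (0 : ℝ) < R := by exact_mod_cast hR
    positivity
  choose N hNcard hNball hN using fun k => exists_norming_finset (d k)
  let net := Fintype.piFinset N
  have hnet : net.card ≤ 5 ^ ∑ k, d k := by
    rw [Fintype.card_piFinset, ← Finset.prod_pow_eq_pow_sum]
    exact Finset.prod_le_prod' fun k _ => hNcard k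
  have hpoint : ∀ y : Idx d → Bool,
      Real.exp (⨆ t, (-(lam * (γ / 2) * ∑ i, (T t i - Θ i) ^ 2) +
          ∑ i, (if y i then 1 else -1) * (lam * L * (T t i - Θ i)))) ≤
        ∑ z ∈ net, Real.exp ((∑ i, (if y i then 1 else -1) * ∏ k, z k (i k)) ^ 2 / 4) := by
    intro y
    let ε : RealTensor d := fun i => if y i then 1 else -1
    obtain ⟨z₁, hz₁, -⟩ := exists_multiForm_le_net N hN ε 0 (by simp)
    obtain ⟨z₀, hz₀, hmax⟩ := net.exists_max_image (multiForm ε) ⟨z₁, hz₁⟩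
    have hs : ∀ x, (∀ k, ‖x k‖ ≤ 1) → multiForm ε x ≤ 2 ^ (K + 1) * multiForm ε z₀ := by
      intro x hx
      obtain ⟨z, hz, hxz⟩ := exists_multiForm_le_net N hN ε x hx
      exact hxz.trans (mul_le_mul_of_nonneg_left (hmax z hz) (by positivity))
    refine le_trans (Real.exp_le_exp.2 (ciSup_le fun t => ?_))
      (Finset.single_le_sum (f := fun z : (k : Fin (K + 1)) → EuclideanSpace ℝ (Fin (d k)) =>
        Real.exp ((∑ i, (if y i then 1 else -1) * ∏ k, z k (i k)) ^ 2 / 4))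
        (fun z _ => (Real.exp_pos _).le) hz₀)
    have hdual := sum_mul_sub_le hΘ (hT t) hs
    set Q := ∑ i, (T t i - Θ i) ^ 2
    have hQ : Real.sqrt Q ^ 2 = Q := Real.sq_sqrt (Finset.sum_nonneg fun _ _ => sq_nonneg _)
    have hM : Real.sqrt ((2 * R : ℝ) ^ K) ^ 2 = (2 * R) ^ K := Real.sq_sqrt hRpos.le
    have hM0 : 0 < Real.sqrt ((2 * R : ℝ) ^ K) := Real.sqrt_pos.2 hRpos
    have hlin : ∑ i, (if y i then 1 else -1) * (lam * L * (T t i - Θ i)) =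
        lam * L * ∑ i, ε i * (T t i - Θ i) := by
      rw [Finset.mul_sum]
      exact Finset.sum_congr rfl fun i _ => by simp only [ε]; ring
    have hform : ∑ i, (if y i then 1 else -1) * ∏ k, z₀ k (i k) = multiForm ε z₀ := rfl
    have hlam0 : 0 < lam := by rw [hlam]; positivity
    rw [hlin, hform]
    rw [← hM] at hlam
    generalize Real.sqrt ((2 * R : ℝ) ^ K) = M at *
    generalize multiForm ε z₀ = z at *
    have h4 : (4 : ℝ) ^ (K + 1) = (2 ^ (K + 1)) ^ 2 := by
      rw [← pow_mul, mul_comm, pow_mul]; norm_num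
    rw [h4] at hlam
    have h2 : (0 : ℝ) < 2 ^ (K + 1) := by positivity
    generalize (2 : ℝ) ^ (K + 1) = P at *
    -- `lam` is chosen so that the remainder after completing the square is exactly the exponent
    -- z²/4 of `rademacher_exp_sq_le`.
    have hexact : z ^ 2 / 4 = lam * (L ^ 2 * (P * z * M) ^ 2 / (2 * γ)) := by
      rw [hlam]
      field_simp
      ring
    rw [hexact, ← hQ]
    have hquad : L * (P * z * M * Real.sqrt Q) - γ / 2 * Real.sqrt Q ^ 2 ≤
        L ^ 2 * (P * z * M) ^ 2 / (2 * γ) := by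
      rw [le_div_iff₀ (by positivity)]
      nlinarith [sq_nonneg (γ * Real.sqrt Q - L * (P * z * M))]
    have := mul_le_mul_of_nonneg_left hdual (mul_pos hlam0 hL).le
    have := mul_le_mul_of_nonneg_left hquad hlam0.le
    linarith
  calc _ ≤ ∑ y : Idx d → Bool, (∏ _i : Idx d, (1 / 2 : ℝ)) *
        ∑ z ∈ net, Real.exp ((∑ i, (if y i then 1 else -1) * ∏ k, z k (i k)) ^ 2 / 4) :=
        Finset.sum_le_sum fun y _ => mul_le_mul_of_nonneg_left (hpoint y)
          (Finset.prod_nonneg fun _ _ => by norm_num)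
    _ = ∑ z ∈ net, ∑ y : Idx d → Bool, (∏ _i : Idx d, (1 / 2 : ℝ)) *
        Real.exp ((∑ i, (if y i then 1 else -1) * ∏ k, z k (i k)) ^ 2 / 4) := by
        simp_rw [Finset.mul_sum]
        exact Finset.sum_comm
    _ ≤ ∑ _z ∈ net, Real.sqrt 2 := by
        refine Finset.sum_le_sum fun z hz => rademacher_exp_sq_le _ ?_
        rw [sum_sq_prod_eq]
        exact Finset.prod_le_one (fun _ _ => sq_nonneg _) fun k _ =>
          pow_le_one₀ (norm_nonneg _) (hNball k _ (Fintype.mem_piFinset.1 hz k))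
    _ ≤ _ := by
        rw [Finset.sum_const, nsmul_eq_mul]
        gcongr
        exact_mod_cast hnet

/-- Tail bound for the Frobenius error of the maximum likelihood estimator. -/
theorem measureReal_error_gt_le {K : ℕ} {d : Fin (K + 1) → ℕ} {R : ℕ} (hR : 1 ≤ R)
    {f : ℝ → ℝ} {α m l L : ℝ} (hf : LinkRegular f α m l L) (hm : 0 < m) (hl : 0 < l) (hL : 0 < L)
    {D : Set (RealTensor d)} (hD : D ⊆ signalSet d R α) {Θ : RealTensor d} (hΘ : Θ ∈ D)
    {Θhat : BinTensor d → RealTensor d} (hmle : ∀ y, IsConstrainedMLE f D y (Θhat y))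
    {Ω : Type*} [MeasurableSpace Ω] {μ : Measure Ω} [IsProbabilityMeasure μ]
    {Y : Ω → BinTensor d} (hY : FollowsBernoulliModel μ f Θ Y) {δ : ℝ} (hδ : 0 ≤ δ) :
    μ.real {ω | δ < frobeniusNorm (Θhat (Y ω) - Θ)} ≤
      Real.exp (-((m * l ^ 2 / 2) ^ 2 * δ ^ 2 / (4 ^ (K + 2) * L ^ 2 * (2 * R) ^ K))) *
        (5 ^ (∑ k, d k) * Real.sqrt 2) := by
  classical
  set γ := m * l ^ 2 / 2 with hγdef
  have hγ : 0 < γ := by positivity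
  have hR0 : (0 : ℝ) < R := by exact_mod_cast hR
  obtain ⟨lam, hlam⟩ : ∃ lam, lam = γ / (2 * 4 ^ (K + 1) * L ^ 2 * (2 * R) ^ K) := ⟨_, rfl⟩
  have hlam0 : 0 < lam := by rw [hlam]; positivity
  have hbd : ∀ Θ ∈ D, ∀ i, |Θ i| ≤ α := fun Θ h => (hD h).2
  let S : Finset (BinTensor d) := Finset.univ.filter fun y => δ < frobeniusNorm (Θhat y - Θ)
  have hS : {ω | δ < frobeniusNorm (Θhat (Y ω) - Θ)} = {ω | Y ω ∈ S} := by
    ext ω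
    simp [S]
  let W : BinTensor d → ℝ := fun y => ∏ i, if y i then f (Θ i) else 1 - f (Θ i)
  have hp0 : ∀ i, 0 ≤ f (Θ i) := fun i => (hf.pos _ (hbd Θ hΘ i)).le
  have hp1 : ∀ i, f (Θ i) ≤ 1 := fun i => (hf.lt_one _ (hbd Θ hΘ i)).le
  have hW : ∀ y, 0 ≤ W y := fun y => Finset.prod_nonneg fun i _ => by
    split_ifs
    exacts [hp0 i, sub_nonneg.2 (hp1 i)]
  -- The supremum runs over the finitely many values of the estimator, indexed by a data tensor `t`
  -- independent of `y`; taking `t = y` recovers the actual estimate.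
  let G : BinTensor d → BinTensor d → ℝ := fun y t =>
    -(lam * (γ / 2) * ∑ i, (Θhat t i - Θ i) ^ 2) + ∑ i, ((if y i then 1 else 0) - f (Θ i)) *
      (lam * (logit (f (Θhat t i)) - logit (f (Θ i))))
  have hG : ∀ y ∈ S, lam * (γ / 2) * δ ^ 2 ≤ ⨆ t, G y t := by
    intro y hy
    refine le_trans ?_ (le_iSup_of_finite (G y) y)
    have h1 := (hmle y).basic_inequality hf hm.le hl.le hbd hΘ
    rw [← hγdef] at h1
    have h2 : δ ^ 2 ≤ ∑ i, (Θhat y i - Θ i) ^ 2 := by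
      have h3 := (Finset.mem_filter.1 hy).2.le
      unfold frobeniusNorm at h3
      rw [← Real.sq_sqrt (Finset.sum_nonneg fun i (_ : i ∈ Finset.univ) =>
        sq_nonneg (Θhat y i - Θ i))]
      exact pow_le_pow_left₀ hδ h3 2
    have h4 : ∑ i, ((if y i then 1 else 0) - f (Θ i)) *
        (lam * (logit (f (Θhat y i)) - logit (f (Θ i)))) =
          lam * ∑ i, ((if y i then 1 else 0) - f (Θ i)) *
            (logit (f (Θhat y i)) - logit (f (Θ i))) := by
      rw [Finset.mul_sum]
      exact Finset.sum_congr rfl fun i _ => mul_left_comm _ _ _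
    have h5 := mul_le_mul_of_nonneg_left h1 hlam0.le
    have h6 := mul_le_mul_of_nonneg_left h2 (show 0 ≤ lam * (γ / 2) by positivity)
    simp only [G]
    rw [h4]
    linarith
  have key := bernoulli_sup_le_rademacher_sup (τ := BinTensor d) (fun i => f (Θ i)) hp0 hp1
    (fun t => -(lam * (γ / 2) * ∑ i, (Θhat t i - Θ i) ^ 2))
    (fun i t => lam * (logit (f (Θhat t i)) - logit (f (Θ i))))
    (fun i t => lam * L * (Θhat t i - Θ i))
    (fun i t s => by
      rw [← mul_sub, ← mul_sub, abs_mul, abs_mul, abs_mul, sub_sub_sub_cancel_right,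
        sub_sub_sub_cancel_right, abs_of_pos hL, mul_assoc]
      exact mul_le_mul_of_nonneg_left
        (hf.upper _ _ (hbd _ (hmle t).1 i) (hbd _ (hmle s).1 i)) (abs_nonneg _))
    (fun i t => by
      rw [abs_mul, abs_mul, abs_mul, abs_of_pos hL, mul_assoc]
      exact mul_le_mul_of_nonneg_left
        (hf.upper _ _ (hbd _ (hmle t).1 i) (hbd _ hΘ i)) (abs_nonneg _))
  have hrad := rademacher_penalized_sup_le hR Θ Θhat (hD hΘ).1.1 (fun t => (hD (hmle t).1).1.1)
    hγ hL hlam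
  have hexp : (γ ^ 2 * δ ^ 2 / (4 ^ (K + 2) * L ^ 2 * (2 * R) ^ K)) = lam * (γ / 2) * δ ^ 2 := by
    rw [hlam, pow_succ 4 (K + 1)]
    field_simp
    ring
  rw [hS, hexp]
  calc _ ≤ ∑ y ∈ S, W y := hY.measureReal_le_sum S
    -- Chernoff's argument: on `S` the inserted exponential weight is at least 1 by `hG`.
    _ ≤ ∑ y ∈ S, Real.exp (-(lam * (γ / 2) * δ ^ 2)) * (W y * Real.exp (⨆ t, G y t)) := by
        refine Finset.sum_le_sum fun y hy => ?_
        rw [mul_left_comm, ← Real.exp_add]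
        exact le_mul_of_one_le_right (hW y) (Real.one_le_exp (by linarith [hG y hy]))
    _ ≤ ∑ y, Real.exp (-(lam * (γ / 2) * δ ^ 2)) * (W y * Real.exp (⨆ t, G y t)) :=
        Finset.sum_le_sum_of_subset_of_nonneg (Finset.subset_univ S) fun y _ _ =>
          mul_nonneg (Real.exp_pos _).le (mul_nonneg (hW y) (Real.exp_pos _).le)
    _ ≤ _ := by
        rw [← Finset.mul_sum]
        exact mul_le_mul_of_nonneg_left (key.trans hrad) (Real.exp_pos _).le

/-! ### Choice of constants and conclusion. -/

theorem loss_le_two_mul {K : ℕ} {d : Fin K → ℕ} {α : ℝ} (hα : 0 ≤ α) {Θ Θ' : RealTensor d}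
    (h : ∀ i, |Θ i| ≤ α) (h' : ∀ i, |Θ' i| ≤ α) : loss Θ Θ' ≤ 2 * α := by
  have h1 : ∑ i, (Θ - Θ') i ^ 2 ≤ (∏ k, (d k : ℝ)) * (2 * α) ^ 2 := by
    have h2 : ∀ i, (Θ - Θ') i ^ 2 ≤ (2 * α) ^ 2 := fun i => by
      rw [← sq_abs, Pi.sub_apply]
      exact pow_le_pow_left₀ (abs_nonneg _)
        ((abs_sub _ _).trans (by linarith [h i, h' i])) 2
    refine (Finset.sum_le_sum fun i _ => h2 i).trans (le_of_eq ?_)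
    rw [Finset.sum_const, nsmul_eq_mul, Finset.card_univ, Fintype.card_pi]
    simp
  have h3 : (0 : ℝ) ≤ ∏ k, (d k : ℝ) := Finset.prod_nonneg fun _ _ => Nat.cast_nonneg _
  unfold loss frobeniusNorm
  calc _ ≤ 1 / Real.sqrt (∏ k, (d k : ℝ)) * (Real.sqrt (∏ k, (d k : ℝ)) * (2 * α)) := by
        refine mul_le_mul_of_nonneg_left ?_ (by positivity)
        rw [← Real.sqrt_sq (show 0 ≤ 2 * α by linarith), ← Real.sqrt_mul h3]
        exact Real.sqrt_le_sqrt h1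
    _ = (Real.sqrt (∏ k, (d k : ℝ)) / Real.sqrt (∏ k, (d k : ℝ))) * (2 * α) := by ring
    -- An inequality rather than an equality, which covers a vanishing product of dimensions.
    _ ≤ _ := mul_le_of_le_one_left (by linarith) (div_self_le_one _)

/-- 5 ≤ e² and √2 ≤ e, whence the 3. For n = 0 the bound fails. -/
theorem five_pow_mul_sqrt_two_le {n : ℕ} (hn : n ≠ 0) :
    (5 : ℝ) ^ n * Real.sqrt 2 ≤ Real.exp (3 * n) := by
  have he : (2.7 : ℝ) ≤ Real.exp 1 := by linarith [Real.exp_one_gt_d9]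
  have h1 : Real.sqrt 2 ≤ Real.exp 1 ^ n := by
    refine le_trans ?_ (le_self_pow₀ (by linarith) hn)
    rw [Real.sqrt_le_left (Real.exp_pos _).le]
    nlinarith
  have h2 : (5 : ℝ) ^ n ≤ (Real.exp 1 ^ 2) ^ n := by
    gcongr
    nlinarith
  calc _ ≤ (Real.exp 1 ^ 2) ^ n * Real.exp 1 ^ n := by gcongr
    _ = _ := by
      rw [← pow_mul, ← pow_add, ← Real.exp_nat_mul]
      congr 1
      push_cast
      ring

end BinaryTensor

theorem corollary1 :
    ∃ C' : ℝ, 0 < C' ∧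
      ∀ K : ℕ, 1 ≤ K →
        ∃ C₁ C₂ C₃ : ℝ, 0 < C₁ ∧ 0 < C₂ ∧ 0 < C₃ ∧
          ∀ (link : BinaryTensor.Link) (d : Fin K → ℕ) (R : ℕ) (α σ : ℝ)
            (D : Set (BinaryTensor.RealTensor d)) (Θtrue : BinaryTensor.RealTensor d)
            (Θhat : BinaryTensor.BinTensor d → BinaryTensor.RealTensor d)
            (Ω : Type*) [MeasurableSpace Ω] (μ : MeasureTheory.Measure Ω)
            [MeasureTheory.IsProbabilityMeasure μ] (Y : Ω → BinaryTensor.BinTensor d),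
            1 ≤ R → 0 < α → 0 < σ →
            D ⊆ BinaryTensor.signalSet d R α → IsCompact D → Θtrue ∈ D →
            BinaryTensor.FollowsBernoulliModel μ (link.fn σ) Θtrue Y →
            (∀ y, BinaryTensor.IsConstrainedMLE (link.fn σ) D y (Θhat y)) →
            1 - Real.exp (-(C' * Real.log K * ∑ k, (d k : ℝ))) ≤
              μ.real {ω | BinaryTensor.loss (Θhat (Y ω)) Θtrue ≤
                min (2 * α)
                  (link.scaleFactor C₁ C₂ C₃ α σ *
                    Real.sqrt ((R : ℝ) ^ (K - 1) * (∑ k, (d k : ℝ)) / ∏ k, (d k : ℝ)))} := by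
  obtain ⟨κ, hκ, hlink⟩ := BinaryTensor.exists_linkRegular
  refine ⟨1, one_pos, fun K hK => ?_⟩
  obtain ⟨K, rfl⟩ : ∃ K', K = K' + 1 := ⟨K - 1, by omega⟩
  have hlog : 0 ≤ Real.log ((K + 1 : ℕ) : ℝ) := Real.log_natCast_nonneg _
  -- The first factors cancel the denominator of the tail exponent. Of `log K + 3`, the 3 pays for
  -- the net and `log K` is left for the probability, so that C' = 1.
  set A := Real.sqrt (4 ^ (K + 2) * 2 ^ K * (Real.log ((K + 1 : ℕ) : ℝ) + 3)) with hA
  have hA0 : 0 < A := Real.sqrt_pos.2 (by positivity)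
  have hA2 : A ^ 2 = 4 ^ (K + 2) * 2 ^ K * (Real.log ((K + 1 : ℕ) : ℝ) + 3) :=
    Real.sq_sqrt (by positivity)
  refine ⟨2 * κ * A * 1, 2 * κ * A * 1, 2 * κ * A * 1, by positivity, by positivity,
    by positivity, ?_⟩
  intro link d R α σ D Θ Θhat Ω _ μ _ Y hR hα hσ hD _ hΘ hY hmle
  obtain ⟨m, l, L, hm, hl, hL, hreg, hbound⟩ := hlink link α σ hα hσ
  rw [BinaryTensor.scaleFactor_mul, Nat.add_sub_cancel, one_mul]
  have hcast : (∑ k, (d k : ℝ)) = ((∑ k, d k : ℕ) : ℝ) := by push_cast; rfl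
  -- If all dimensions vanish, the claimed probability bound is 1 - e^0 = 0.
  rcases eq_or_ne (∑ k, d k) 0 with hzero | hne
  · rw [hcast, hzero]
    simp
  have hR0 : (0 : ℝ) < R := by exact_mod_cast hR
  set V := (R : ℝ) ^ K * ∑ k, (d k : ℝ) with hV
  have hV0 : 0 ≤ V := by positivity
  set δ := A * (2 * (L / (m * l ^ 2))) * Real.sqrt V with hδdef
  have hδ : 0 ≤ δ := by positivity
  have htail := BinaryTensor.measureReal_error_gt_le hR hreg hm hl hL hD hΘ hmle hY hδ
  have hexp : (m * l ^ 2 / 2) ^ 2 * δ ^ 2 / (4 ^ (K + 2) * L ^ 2 * (2 * R) ^ K) =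
      (Real.log ((K + 1 : ℕ) : ℝ) + 3) * ∑ k, (d k : ℝ) := by
    rw [hδdef, mul_pow, mul_pow, Real.sq_sqrt hV0, hA2, hV, mul_pow 2 (R : ℝ)]
    field_simp
  have hprob : μ.real {ω | δ < BinaryTensor.frobeniusNorm (Θhat (Y ω) - Θ)} ≤
      Real.exp (-(Real.log ((K + 1 : ℕ) : ℝ) * ∑ k, (d k : ℝ))) := by
    refine htail.trans ?_
    rw [hexp]
    refine (mul_le_mul_of_nonneg_left (BinaryTensor.five_pow_mul_sqrt_two_le hne)
      (Real.exp_pos _).le).trans (le_of_eq ?_)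
    rw [← Real.exp_add, hcast]
    congr 1
    ring
  have hmeas : MeasurableSet {ω | δ < BinaryTensor.frobeniusNorm (Θhat (Y ω) - Θ)} :=
    (measurable_pi_lambda Y hY.measurable)
      (Set.toFinite {y | δ < BinaryTensor.frobeniusNorm (Θhat y - Θ)}).measurableSet
  have hcompl := MeasureTheory.probReal_compl_eq_one_sub (μ := μ) hmeas
  refine le_trans (by linarith) (hcompl.ge.trans (MeasureTheory.measureReal_mono ?_))
  intro ω hω
  have hω : BinaryTensor.frobeniusNorm (Θhat (Y ω) - Θ) ≤ δ := not_lt.1 hω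
  refine le_min (BinaryTensor.loss_le_two_mul hα.le (hD (hmle _).1).2 (hD hΘ).2) ?_
  calc BinaryTensor.loss (Θhat (Y ω)) Θ ≤ 1 / Real.sqrt (∏ k, (d k : ℝ)) * δ :=
        mul_le_mul_of_nonneg_left hω (by positivity)
    _ = A * 2 * (L / (m * l ^ 2)) * Real.sqrt (V / ∏ k, (d k : ℝ)) := by
        rw [Real.sqrt_div hV0, hδdef]; ring
    _ ≤ A * 2 * (κ * link.scaleFactor 1 1 1 α σ) * Real.sqrt (V / ∏ k, (d k : ℝ)) := by
        gcongr
    _ = _ := by ring
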